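/- Let $d\ge 0$ and let $G=\mathbb R^{2d}\rtimes Sp(d,\mathbb R)$, with group law $(z,A)(z',A')=(z+Az',AA')$. For $z=(x,\xi)\in\mathbb R^{2d}$ and $t\in\mathbb R$ let $\rho(z,t)$ be the unitary operator on $L^2(\mathbb R^d)$ $$\rho(z,t)f(y)=e^{2\pi i t}e^{-\pi i\langle x,\xi\rangle}e^{2\pi i\langle \xi,y\rangle}f(y-x).$$ For $A\in Sp(d,\mathbb R)$ let $\mu(A)$ be a unitary operator on $L^2(\mathbb R^d)$ with $\rho(Az,t)=\mu(A)\rho(z,t)\mu(A)^{-1}$ for all $(z,t)$; it exists and is unique up to a phase factor, which plays no role below. Put $\mu_e(z,A)=\rho(z,0)\mu(A)$. Let $H$ be a connected Lie subgroup of $G$ with left Haar measure $dh$. Inner products $\langle f,g\rangle=\int f\overline g$ are linear in the first argument. A function $\phi\in L^2(\mathbb R^d)$ is a *reproducing function* for $H$ if $f=\int_H\langle f,\mu_e(h)\phi\rangle\,\mu_e(h)\phi\,dh$ weakly for all $f\in L^2(\mathbb R^d)$, that is, for all $f,g\in L^2(\mathbb R^d)$ the function $h\mapsto\langle f,\mu_e(h)\phi\rangle\langle\mu_e(h)\phi,g\rangle$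 is integrable on $H$ and $\int_H\langle f,\mu_e(h)\phi\rangle\langle\mu_e(h)\phi,g\rangle\,dh=\langle f,g\rangle$. The group $H$ is *reproducing* if a reproducing function exists. The Wigner distribution of $f$ is $W_f(x,\xi)=\int_{\mathbb R^d}e^{-2\pi i\langle\xi,y\rangle}f(x+\tfrac y2)\overline{f(x-\tfrac y2)}\,dy$, and $V$ is the complex linear span of $\{W_f: f\in\mathcal S(\mathbb R^d)\}$. For $\phi\in L^2(\mathbb R^d)$ consider the condition $$(*)\qquad \int_H\langle W_{\mu_e(h)\phi},F\rangle\,dh=\langle 1,F\rangle\quad\text{for all }F\in V,$$ which includes that $h\mapsto\langle W_{\mu_e(h)\phi},F\rangle=\int_{\mathbb R^{2d}}W_{\mu_e(h)\phi}\overline F$ is integrable on $H$ for every $F\in V$. The group $H$ is *weakly admissible* if there is $\phi\in L^2(\mathbb R^d)$ satisfying $(*)$. **Theorem.** For every $\phi\in L^2(\mathbb R^d)$ the following are equivalent: (i) $H$ is weakly admissible and $(*)$ holds for $\phi$; (ii) $H$ is reproducing and $\phi$ is a reproducing function for $H$. -/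

import Mathlib

open MeasureTheory Matrix
open scoped ComplexConjugate SchwartzMap FourierTransform

noncomputable section

namespace PhaseSpace

/-- The Euclidean space `ℝᵈ`. -/
abbrev Rd (d : ℕ) : Type := EuclideanSpace ℝ (Fin d)

/-- The Hilbert space `L²(ℝᵈ)`, with Lebesgue measure. -/
abbrev L2 (d : ℕ) : Type := Lp ℂ 2 (volume : Measure (Rd d))

/-- Points `z = (x, ξ)` of the phase space `ℝ²ᵈ`, as column vectors on which `2d × 2d` matrices
act. -/
abbrev Phase (d : ℕ) : Type := Fin d ⊕ Fin d → ℝ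

/-- The space component `x` of `z = (x, ξ)`. -/
def pos {d : ℕ} (z : Phase d) : Rd d := WithLp.toLp 2 fun i => z (Sum.inl i)

/-- The frequency component `ξ` of `z = (x, ξ)`. -/
def mom {d : ℕ} (z : Phase d) : Rd d := WithLp.toLp 2 fun i => z (Sum.inr i)

/-- The function `e^{2πit} e^{-πi⟨x,ξ⟩} e^{2πi⟨ξ,y⟩} f(y - x)` of `y`. -/
def schrodingerFun {d : ℕ} (z : Phase d) (t : ℝ) (f : Rd d → ℂ) (y : Rd d) : ℂ :=
  Complex.exp (2 * Real.pi * Complex.I * t) *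
    Complex.exp (-(Real.pi * Complex.I * (inner ℝ (pos z) (mom z) : ℝ))) *
    Complex.exp (2 * Real.pi * Complex.I * (inner ℝ (mom z) y : ℝ)) * f (y - pos z)

theorem memLp_schrodingerFun {d : ℕ} (z : Phase d) (t : ℝ) (f : L2 d) :
    MemLp (schrodingerFun z t f) 2 (volume : Measure (Rd d)) := by
  have h1 : MemLp (fun y => f (y - pos z)) 2 (volume : Measure (Rd d)) :=
    (Lp.memLp f).comp_measurePreserving (measurePreserving_sub_right volume (pos z))
  refine MemLp.of_le h1 ?_ (Filter.Eventually.of_forall fun y => ?_)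
  · refine AEStronglyMeasurable.mul ?_ h1.1
    refine Continuous.aestronglyMeasurable ?_
    fun_prop
  · have e1 : ‖Complex.exp (2 * Real.pi * Complex.I * t)‖ = 1 := by
      rw [Complex.norm_exp]; simp
    have e2 : ‖Complex.exp (-(Real.pi * Complex.I * (inner ℝ (pos z) (mom z) : ℝ)))‖ = 1 := by
      rw [Complex.norm_exp]; simp
    have e3 : ‖Complex.exp (2 * Real.pi * Complex.I * (inner ℝ (mom z) y : ℝ))‖ = 1 := by
      rw [Complex.norm_exp]; simp
    simp only [schrodingerFun, norm_mul, e1, e2, e3, one_mul, le_refl]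

/-- The Schrödinger representation `ρ(z, t)` of the Heisenberg group on `L²(ℝᵈ)`. -/
def schrodinger {d : ℕ} (z : Phase d) (t : ℝ) (f : L2 d) : L2 d :=
  (memLp_schrodingerFun z t f).toLp _

/-- The unitary operator `U` intertwines `ρ` with `ρ_A(z, t) = ρ(Az, t)`, that is,
`ρ(Az, t) = U ∘ ρ(z, t) ∘ U⁻¹` for all `(z, t)`. -/
def IsMetaplectic {d : ℕ} (A : Matrix (Fin d ⊕ Fin d) (Fin d ⊕ Fin d) ℝ)
    (U : L2 d ≃ₗᵢ[ℂ] L2 d) : Prop :=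
  ∀ (z : Phase d) (t : ℝ) (f : L2 d), schrodinger (A *ᵥ z) t f = U (schrodinger z t (U.symm f))


theorem coeFn_schrodinger {d : ℕ} (z : Phase d) (t : ℝ) (f : L2 d) :
    schrodinger z t f =ᵐ[volume] schrodingerFun z t f :=
  MemLp.coeFn_toLp _

theorem IsMetaplectic.of_comm {d : ℕ} {A : Matrix (Fin d ⊕ Fin d) (Fin d ⊕ Fin d) ℝ}
    {U : L2 d ≃ₗᵢ[ℂ] L2 d}
    (h : ∀ z t f, schrodinger (A *ᵥ z) t (U f) = U (schrodinger z t f)) : IsMetaplectic A U := by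
  intro z t f
  rw [← h, LinearIsometryEquiv.apply_symm_apply]

theorem IsMetaplectic.mul {d : ℕ} {A B : Matrix (Fin d ⊕ Fin d) (Fin d ⊕ Fin d) ℝ}
    {U V : L2 d ≃ₗᵢ[ℂ] L2 d} (hA : IsMetaplectic A U) (hB : IsMetaplectic B V) :
    IsMetaplectic (A * B) (V.trans U) := by
  intro z t f
  rw [← Matrix.mulVec_mulVec, hA, hB]
  rfl

theorem IsMetaplectic.inv {d : ℕ} {A B : Matrix (Fin d ⊕ Fin d) (Fin d ⊕ Fin d) ℝ}
    {U : L2 d ≃ₗᵢ[ℂ] L2 d} (hA : IsMetaplectic A U) (hAB : A * B = 1) :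
    IsMetaplectic B U.symm := by
  intro z t f
  have := hA (B *ᵥ z) t (U f)
  rw [Matrix.mulVec_mulVec, hAB, Matrix.one_mulVec, LinearIsometryEquiv.symm_apply_apply] at this
  rw [LinearIsometryEquiv.symm_symm, this, LinearIsometryEquiv.symm_apply_apply]

/-- Weighted composition with an invertible linear map is unitary for the right weight. -/
theorem exists_weighted_comp {d : ℕ} (w : Rd d → ℂ) (hw : Continuous w) (a : Rd d ≃L[ℝ] Rd d)
    (hn : ∀ y, ‖w y‖ ^ 2 = |LinearMap.det (a : Rd d →ₗ[ℝ] Rd d)|) :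
    ∃ U : L2 d ≃ₗᵢ[ℂ] L2 d, ∀ f : L2 d, U f =ᵐ[volume] fun y => w y * f (a y) := by
  have hdet : LinearMap.det (a : Rd d →ₗ[ℝ] Rd d) ≠ 0 := a.toLinearEquiv.isUnit_det'.ne_zero
  have hmap : Measure.map a (volume : Measure (Rd d)) =
      ENNReal.ofReal |(LinearMap.det (a : Rd d →ₗ[ℝ] Rd d))⁻¹| • volume :=
    Measure.map_linearMap_addHaar_eq_smul_addHaar volume hdet
  have hqmp : Measure.QuasiMeasurePreserving a (volume : Measure (Rd d)) volume :=
    ⟨a.continuous.measurable, by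
      rw [hmap]; exact Measure.smul_absolutelyContinuous⟩
  have hdet' : LinearMap.det (a.symm : Rd d →ₗ[ℝ] Rd d) ≠ 0 :=
    a.symm.toLinearEquiv.isUnit_det'.ne_zero
  have hqmp' : Measure.QuasiMeasurePreserving a.symm (volume : Measure (Rd d)) volume :=
    ⟨a.symm.continuous.measurable, by
      have := Measure.map_linearMap_addHaar_eq_smul_addHaar (volume : Measure (Rd d)) hdet'
      change Measure.map (a.symm : Rd d →ₗ[ℝ] Rd d) _ ≪ _
      rw [this]; exact Measure.smul_absolutelyContinuous⟩
  have hw0 : ∀ y, w y ≠ 0 := fun y h => by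
    have := hn y
    rw [h] at this
    simp at this
    exact hdet (by simpa using this.symm)
  have hpt : ∀ (f : Rd d → ℂ) (y : Rd d), ‖w y * f (a y)‖ₑ ^ (2 : ℝ) =
      ENNReal.ofReal |LinearMap.det (a : Rd d →ₗ[ℝ] Rd d)| * ‖f (a y)‖ₑ ^ (2 : ℝ) := by
    intro f y
    rw [enorm_mul, ENNReal.mul_rpow_of_nonneg _ _ (by norm_num), ← hn y,
      ENNReal.ofReal_pow (norm_nonneg _), ofReal_norm]
    norm_num
  have hlint : ∀ f : Rd d → ℂ, AEStronglyMeasurable f volume →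
      ∫⁻ y, ‖w y * f (a y)‖ₑ ^ (2 : ℝ) = ∫⁻ y, ‖f y‖ₑ ^ (2 : ℝ) := by
    intro f hf
    simp_rw [hpt]
    rw [lintegral_const_mul' _ _ ENNReal.ofReal_ne_top,
      ← lintegral_map' (f := fun y => ‖f y‖ₑ ^ (2 : ℝ)) (g := a) ?_
        a.continuous.measurable.aemeasurable, hmap,
      lintegral_smul_measure, smul_eq_mul, ← mul_assoc, ← ENNReal.ofReal_mul (abs_nonneg _),
      ← abs_mul, mul_inv_cancel₀ hdet]
    · simp
    · rw [hmap]
      exact (hf.enorm.pow_const _).smul_measure _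
  have hnorm : ∀ f : Rd d → ℂ, AEStronglyMeasurable f volume →
      eLpNorm (fun y => w y * f (a y)) 2 volume = eLpNorm f 2 volume := by
    intro f hf
    simp only [eLpNorm_eq_lintegral_rpow_enorm_toReal (p := 2) (by norm_num) (by norm_num),
      ENNReal.toReal_ofNat, hlint f hf]
  have hmem : ∀ f : L2 d, MemLp (fun y => w y * f (a y)) 2 (volume : Measure (Rd d)) := fun f =>
    ⟨hw.aestronglyMeasurable.mul ((Lp.aestronglyMeasurable f).comp_quasiMeasurePreserving hqmp), by
      rw [hnorm f (Lp.aestronglyMeasurable f)]; exact (Lp.memLp f).2⟩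
  let T : L2 d →ₗᵢ[ℂ] L2 d :=
    { toFun := fun f => (hmem f).toLp _
      map_add' := fun f g => by
        rw [← MemLp.toLp_add]
        refine MemLp.toLp_congr _ _ ?_
        filter_upwards [hqmp.ae (Lp.coeFn_add f g)] with y hy
        simp only [hy, Pi.add_apply, mul_add]
      map_smul' := fun c f => by
        rw [RingHom.id_apply, ← MemLp.toLp_const_smul]
        refine MemLp.toLp_congr _ _ ?_
        filter_upwards [hqmp.ae (Lp.coeFn_smul c f)] with y hy
        simp only [hy, Pi.smul_apply, smul_eq_mul]
        ring
      norm_map' := fun f => by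
        change ‖(hmem f).toLp _‖ = _
        rw [Lp.norm_toLp, Lp.norm_def, hnorm f (Lp.aestronglyMeasurable f)] }
  have hT : ∀ f : L2 d, T f =ᵐ[volume] fun y => w y * f (a y) := fun f => (hmem f).coeFn_toLp
  have hsurj : Function.Surjective T := by
    intro g
    have hinv : ∀ y, w y * ((w (a.symm (a y)))⁻¹ * g (a.symm (a y))) = g y := fun y => by
      rw [ContinuousLinearEquiv.symm_apply_apply, ← mul_assoc, mul_inv_cancel₀ (hw0 y), one_mul]
    have hgm : AEStronglyMeasurable (fun y => (w (a.symm y))⁻¹ * g (a.symm y))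
        (volume : Measure (Rd d)) :=
      ((hw.comp a.symm.continuous).inv₀ fun y => hw0 _).aestronglyMeasurable.mul
        ((Lp.aestronglyMeasurable g).comp_quasiMeasurePreserving hqmp')
    have hg : MemLp (fun y => (w (a.symm y))⁻¹ * g (a.symm y)) 2 (volume : Measure (Rd d)) :=
      ⟨hgm, by
        rw [← hnorm _ hgm]
        simp_rw [hinv]
        exact (Lp.memLp g).2⟩
    refine ⟨hg.toLp _, Lp.ext ?_⟩
    filter_upwards [hT (hg.toLp _), hqmp.ae hg.coeFn_toLp] with y h1 h2
    rw [h1, h2, hinv]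
  exact ⟨LinearIsometryEquiv.ofSurjective T hsurj, hT⟩

/-- Covariance of a weighted composition follows from a pointwise identity of weights. -/
theorem isMetaplectic_of_weighted_comp {d : ℕ}
    {A : Matrix (Fin d ⊕ Fin d) (Fin d ⊕ Fin d) ℝ} {U : L2 d ≃ₗᵢ[ℂ] L2 d}
    (w : Rd d → ℂ) (a : Rd d ≃L[ℝ] Rd d)
    (hU : ∀ f : L2 d, U f =ᵐ[volume] fun y => w y * f (a y))
    (hpos : ∀ z, a (pos (A *ᵥ z)) = pos z)
    (hww : ∀ (z : Phase d) (y : Rd d),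
      Complex.exp (-(Real.pi * Complex.I * (inner ℝ (pos (A *ᵥ z)) (mom (A *ᵥ z)) : ℝ))) *
        Complex.exp (2 * Real.pi * Complex.I * (inner ℝ (mom (A *ᵥ z)) y : ℝ)) *
        w (y - pos (A *ᵥ z)) =
      Complex.exp (-(Real.pi * Complex.I * (inner ℝ (pos z) (mom z) : ℝ))) *
        Complex.exp (2 * Real.pi * Complex.I * (inner ℝ (mom z) (a y) : ℝ)) * w y) :
    IsMetaplectic A U := by
  refine IsMetaplectic.of_comm fun z t f => Lp.ext ?_
  have hdet : LinearMap.det (a : Rd d →ₗ[ℝ] Rd d) ≠ 0 := a.toLinearEquiv.isUnit_det'.ne_zero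
  have hqmp : Measure.QuasiMeasurePreserving a (volume : Measure (Rd d)) volume :=
    ⟨a.continuous.measurable, by
      have := Measure.map_linearMap_addHaar_eq_smul_addHaar (volume : Measure (Rd d)) hdet
      change Measure.map (a : Rd d →ₗ[ℝ] Rd d) _ ≪ _
      rw [this]; exact Measure.smul_absolutelyContinuous⟩
  have hsub := (measurePreserving_sub_right (volume : Measure (Rd d))
    (pos (A *ᵥ z))).quasiMeasurePreserving
  filter_upwards [coeFn_schrodinger (A *ᵥ z) t (U f), hU (schrodinger z t f),
    hqmp.ae (coeFn_schrodinger z t f), hsub.ae (hU f)] with y h1 h2 h3 h4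
  rw [h1, h2, h3]
  simp only [schrodingerFun, h4, map_sub, hpos]
  linear_combination (Complex.exp (2 * Real.pi * Complex.I * t) * f (a y - pos z)) * hww z y

theorem exists_isMetaplectic_lower {d : ℕ} (S : Matrix (Fin d) (Fin d) ℝ) (hS : S.IsSymm) :
    ∃ U : L2 d ≃ₗᵢ[ℂ] L2 d, IsMetaplectic (Matrix.fromBlocks 1 0 S 1) U := by
  have hsym : ∀ x y : Rd d, inner ℝ (S.toEuclideanLin x) y = inner ℝ x (S.toEuclideanLin y) := by
    intro x y
    simp only [EuclideanSpace.inner_eq_star_dotProduct, Matrix.toLpLin_apply, star_trivial]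
    rw [dotProduct_comm, dotProduct_comm _ x.ofLp, Matrix.dotProduct_mulVec,
      ← Matrix.mulVec_transpose, hS.eq, dotProduct_comm]
  have hp : ∀ z : Phase d, pos (Matrix.fromBlocks 1 0 S 1 *ᵥ z) = pos z := fun z => by
    ext i; simp [pos, Matrix.fromBlocks_mulVec, Function.comp_def]
  have hm : ∀ z : Phase d,
      mom (Matrix.fromBlocks 1 0 S 1 *ᵥ z) = S.toEuclideanLin (pos z) + mom z := fun z => by
    ext i; simp [pos, mom, Matrix.fromBlocks_mulVec, Function.comp_def, Matrix.toLpLin_apply]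
  obtain ⟨U, hU⟩ := exists_weighted_comp
    (fun y => Complex.exp (Real.pi * Complex.I * (inner ℝ (S.toEuclideanLin y) y : ℝ)))
    (by
      have : Continuous (S.toEuclideanLin : Rd d → Rd d) :=
        LinearMap.continuous_of_finiteDimensional _
      fun_prop) (ContinuousLinearEquiv.refl ℝ (Rd d))
    (fun y => by
      change _ = |LinearMap.det (LinearMap.id : Rd d →ₗ[ℝ] Rd d)|
      rw [Complex.norm_exp, LinearMap.det_id]
      simp)
  refine ⟨U, isMetaplectic_of_weighted_comp _ _ hU (fun z => hp z) fun z y => ?_⟩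
  rw [hp, hm]
  simp only [← Complex.exp_add]
  congr 1
  simp only [map_sub, inner_sub_left, inner_sub_right, inner_add_left, inner_add_right,
    ContinuousLinearEquiv.coe_refl', id_eq, Complex.ofReal_sub, Complex.ofReal_add]
  rw [hsym y (pos z), real_inner_comm (S.toEuclideanLin (pos z)) y,
    real_inner_comm (S.toEuclideanLin (pos z)) (pos z)]
  ring

theorem exists_isMetaplectic_diag {d : ℕ} (P Q : Matrix (Fin d) (Fin d) ℝ) (hPQ : P * Q = 1) :
    ∃ U : L2 d ≃ₗᵢ[ℂ] L2 d, IsMetaplectic (Matrix.fromBlocks P 0 0 Qᵀ) U := by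
  have hQP : Q * P = 1 := mul_eq_one_comm.1 hPQ
  have h1 : ∀ x : Rd d, P.toEuclideanLin (Q.toEuclideanLin x) = x := fun x => by
    ext i; simp [Matrix.toLpLin_apply, hPQ]
  have h2 : ∀ x : Rd d, Q.toEuclideanLin (P.toEuclideanLin x) = x := fun x => by
    ext i; simp [Matrix.toLpLin_apply, hQP]
  let a : Rd d ≃L[ℝ] Rd d :=
    (LinearEquiv.ofLinearMap (Q.toEuclideanLin : Rd d →ₗ[ℝ] Rd d) P.toEuclideanLin
      (LinearMap.ext h2) (LinearMap.ext h1)).toContinuousLinearEquiv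
  have ha : ∀ x : Rd d, a x = Q.toEuclideanLin x := fun x => rfl
  have hp : ∀ z : Phase d, pos (Matrix.fromBlocks P 0 0 Qᵀ *ᵥ z) = P.toEuclideanLin (pos z) :=
    fun z => by
      ext i; simp [pos, Matrix.fromBlocks_mulVec, Function.comp_def, Matrix.toLpLin_apply]
  have hm : ∀ (z : Phase d) (y : Rd d),
      inner ℝ (mom (Matrix.fromBlocks P 0 0 Qᵀ *ᵥ z)) y = inner ℝ (mom z) (a y) := fun z y => by
    rw [ha]
    simp only [EuclideanSpace.inner_eq_star_dotProduct, Matrix.toLpLin_apply, star_trivial, mom]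
    simp only [Matrix.fromBlocks_mulVec, Matrix.zero_mulVec, zero_add, Sum.elim_inr,
      Function.comp_def]
    rw [Matrix.dotProduct_mulVec, Matrix.vecMul_transpose]
  obtain ⟨U, hU⟩ := exists_weighted_comp
    (fun _ => ((Real.sqrt |LinearMap.det (a : Rd d →ₗ[ℝ] Rd d)| : ℝ) : ℂ)) continuous_const a
    (fun y => by
      rw [Complex.norm_real, Real.norm_eq_abs, sq_abs, Real.sq_sqrt (abs_nonneg _)])
  refine ⟨U, isMetaplectic_of_weighted_comp _ a hU (fun z => ?_) fun z y => ?_⟩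
  · rw [hp, ha, h2]
  · rw [real_inner_comm, hm, hm, hp, ha (Matrix.toEuclideanLin P _), h2, real_inner_comm]

theorem isometry_schrodinger {d : ℕ} (z : Phase d) (t : ℝ) :
    Isometry (schrodinger z t : L2 d → L2 d) := by
  refine Isometry.of_dist_eq fun f g => ?_
  rw [dist_eq_norm, dist_eq_norm, ← Lp.norm_compMeasurePreserving (f - g)
    (measurePreserving_sub_right (volume : Measure (Rd d)) (pos z))]
  have hsub := (measurePreserving_sub_right (volume : Measure (Rd d)) (pos z))
  rw [Lp.norm_def, Lp.norm_def]
  congr 1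
  refine eLpNorm_congr_norm_ae ?_
  filter_upwards [Lp.coeFn_sub (schrodinger z t f) (schrodinger z t g),
    coeFn_schrodinger z t f, coeFn_schrodinger z t g,
    Lp.coeFn_compMeasurePreserving (f - g) hsub,
    hsub.quasiMeasurePreserving.ae (Lp.coeFn_sub f g)] with y h1 h2 h3 h4 h5
  rw [h1, h4, Function.comp_apply, h5, Pi.sub_apply, Pi.sub_apply, h2, h3, schrodingerFun,
    schrodingerFun, ← mul_sub, norm_mul, norm_mul, norm_mul, Complex.norm_exp, Complex.norm_exp,
    Complex.norm_exp]
  simp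

/-- Translation by `x`. -/
def translation {d : ℕ} (x : Rd d) : L2 d → L2 d := schrodinger (Sum.elim x.ofLp 0) 0

/-- Modulation by `ξ`. -/
def modulation {d : ℕ} (ξ : Rd d) : L2 d → L2 d := schrodinger (Sum.elim 0 ξ.ofLp) 0

theorem coeFn_translation {d : ℕ} (x : Rd d) (f : L2 d) :
    translation x f =ᵐ[volume] fun y => f (y - x) := by
  filter_upwards [coeFn_schrodinger (Sum.elim x.ofLp 0) 0 f] with y hy
  have h1 : pos (Sum.elim x.ofLp 0) = x := rfl
  have h2 : mom (Sum.elim x.ofLp 0) = 0 := rfl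
  rw [translation, hy, schrodingerFun, h1, h2]
  simp

theorem coeFn_modulation {d : ℕ} (ξ : Rd d) (f : L2 d) :
    modulation ξ f =ᵐ[volume]
      fun y => Complex.exp (2 * Real.pi * Complex.I * (inner ℝ ξ y : ℝ)) * f y := by
  filter_upwards [coeFn_schrodinger (Sum.elim 0 ξ.ofLp) 0 f] with y hy
  have h1 : pos (Sum.elim 0 ξ.ofLp) = 0 := rfl
  have h2 : mom (Sum.elim 0 ξ.ofLp) = ξ := rfl
  rw [modulation, hy, schrodingerFun, h1, h2]
  simp

theorem schrodinger_eq_translation_modulation {d : ℕ} (z : Phase d) (t : ℝ) (f : L2 d) :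
    schrodinger z t f = (Complex.exp (2 * Real.pi * Complex.I * t) *
      Complex.exp (Real.pi * Complex.I * (inner ℝ (pos z) (mom z) : ℝ))) •
        translation (pos z) (modulation (mom z) f) := by
  refine Lp.ext ?_
  have hsub := (measurePreserving_sub_right (volume : Measure (Rd d))
    (pos z)).quasiMeasurePreserving
  filter_upwards [coeFn_schrodinger z t f, Lp.coeFn_smul (Complex.exp (2 * Real.pi * Complex.I * t) *
      Complex.exp (Real.pi * Complex.I * (inner ℝ (pos z) (mom z) : ℝ)))
        (translation (pos z) (modulation (mom z) f)),
    coeFn_translation (pos z) (modulation (mom z) f),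
    hsub.ae (coeFn_modulation (mom z) f)] with y h1 h2 h3 h4
  rw [h1, h2, Pi.smul_apply, h3, h4, schrodingerFun, smul_eq_mul, ← mul_assoc]
  congr 1
  simp only [← Complex.exp_add]
  congr 1
  rw [inner_sub_right, real_inner_comm (mom z) (pos z)]
  push_cast
  ring

theorem schrodinger_eq_modulation_translation {d : ℕ} (z : Phase d) (t : ℝ) (f : L2 d) :
    schrodinger z t f = (Complex.exp (2 * Real.pi * Complex.I * t) *
      Complex.exp (-(Real.pi * Complex.I * (inner ℝ (pos z) (mom z) : ℝ)))) •
        modulation (mom z) (translation (pos z) f) := by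
  refine Lp.ext ?_
  filter_upwards [coeFn_schrodinger z t f, Lp.coeFn_smul (Complex.exp (2 * Real.pi * Complex.I * t) *
      Complex.exp (-(Real.pi * Complex.I * (inner ℝ (pos z) (mom z) : ℝ))))
        (modulation (mom z) (translation (pos z) f)),
    coeFn_modulation (mom z) (translation (pos z) f),
    coeFn_translation (pos z) f] with y h1 h2 h3 h4
  rw [h1, h2, Pi.smul_apply, h3, h4, schrodingerFun, smul_eq_mul, ← mul_assoc]

theorem fourierFun_translation {d : ℕ} (x : Rd d) (f : Rd d → ℂ) (w : Rd d) :
    𝓕 (fun y => f (y - x)) w =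
      Complex.exp (-(2 * Real.pi * Complex.I * (inner ℝ x w : ℝ))) * 𝓕 f w := by
  rw [Real.fourier_eq', Real.fourier_eq', ← integral_const_mul,
    ← integral_add_right_eq_self _ x]
  refine integral_congr_ae (Filter.Eventually.of_forall fun y => ?_)
  simp only [add_sub_cancel_right, smul_eq_mul, ← mul_assoc, ← Complex.exp_add, inner_add_left]
  congr 2
  push_cast
  ring

theorem fourier_translation {d : ℕ} (x : Rd d) (f : L2 d) :
    𝓕 (translation x f) = modulation (-x) (𝓕 f) := by
  have hT : ∀ g : 𝓢(Rd d, ℂ), translation x (g.toLp 2) = (g.compSubConstCLM ℂ x).toLp 2 :=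
    fun g => by
      refine Lp.ext ?_
      have hsub := (measurePreserving_sub_right (volume : Measure (Rd d)) x).quasiMeasurePreserving
      filter_upwards [coeFn_translation x (g.toLp 2), (g.compSubConstCLM ℂ x).coeFn_toLp 2,
        hsub.ae (g.coeFn_toLp 2 volume)] with y h1 h2 h3
      rw [h1, h2, h3, SchwartzMap.compSubConstCLM_apply]
  refine (SchwartzMap.denseRange_toLpCLM (E := Rd d) (F := ℂ) (p := 2)
    (μ := volume) ENNReal.ofNat_ne_top).induction_on
    (p := fun f => 𝓕 (translation x f) = modulation (-x) (𝓕 f)) f ?_ fun g => ?_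
  · exact isClosed_eq
      ((Lp.fourierTransformₗᵢ (Rd d) ℂ).continuous.comp (isometry_schrodinger _ _).continuous)
      ((isometry_schrodinger _ _).continuous.comp (Lp.fourierTransformₗᵢ (Rd d) ℂ).continuous)
  · rw [SchwartzMap.toLpCLM_apply, hT, SchwartzMap.toLp_fourier_eq, SchwartzMap.toLp_fourier_eq]
    refine Lp.ext ?_
    filter_upwards [(𝓕 (g.compSubConstCLM ℂ x)).coeFn_toLp 2,
      coeFn_modulation (-x) ((𝓕 g).toLp 2), (𝓕 g).coeFn_toLp 2] with y h1 h2 h3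
    rw [h1, h2, h3, SchwartzMap.fourier_coe, SchwartzMap.fourier_coe]
    refine (fourierFun_translation x g y).trans ?_
    rw [inner_neg_left]
    push_cast
    ring_nf

theorem fourierInv_translation {d : ℕ} (x : Rd d) (f : L2 d) :
    𝓕⁻ (translation x f) = modulation x (𝓕⁻ f) := by
  have hT : ∀ g : 𝓢(Rd d, ℂ), translation x (g.toLp 2) = (g.compSubConstCLM ℂ x).toLp 2 :=
    fun g => by
      refine Lp.ext ?_
      have hsub := (measurePreserving_sub_right (volume : Measure (Rd d)) x).quasiMeasurePreserving
      filter_upwards [coeFn_translation x (g.toLp 2), (g.compSubConstCLM ℂ x).coeFn_toLp 2,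
        hsub.ae (g.coeFn_toLp 2 volume)] with y h1 h2 h3
      rw [h1, h2, h3, SchwartzMap.compSubConstCLM_apply]
  refine (SchwartzMap.denseRange_toLpCLM (E := Rd d) (F := ℂ) (p := 2)
    (μ := volume) ENNReal.ofNat_ne_top).induction_on
    (p := fun f => 𝓕⁻ (translation x f) = modulation x (𝓕⁻ f)) f ?_ fun g => ?_
  · exact isClosed_eq
      ((Lp.fourierTransformₗᵢ (Rd d) ℂ).symm.continuous.comp
        (isometry_schrodinger _ _).continuous)
      ((isometry_schrodinger _ _).continuous.comp
        (Lp.fourierTransformₗᵢ (Rd d) ℂ).symm.continuous)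
  · rw [SchwartzMap.toLpCLM_apply, hT, SchwartzMap.toLp_fourierInv_eq,
      SchwartzMap.toLp_fourierInv_eq]
    refine Lp.ext ?_
    filter_upwards [(𝓕⁻ (g.compSubConstCLM ℂ x)).coeFn_toLp 2,
      coeFn_modulation x ((𝓕⁻ g).toLp 2), (𝓕⁻ g).coeFn_toLp 2] with y h1 h2 h3
    rw [h1, h2, h3, SchwartzMap.fourierInv_coe, SchwartzMap.fourierInv_coe,
      Real.fourierInv_eq_fourier_neg, Real.fourierInv_eq_fourier_neg]
    refine (fourierFun_translation x g (-y)).trans ?_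
    rw [inner_neg_right]
    push_cast
    ring_nf

theorem fourier_modulation {d : ℕ} (ξ : Rd d) (f : L2 d) :
    𝓕 (modulation ξ f) = translation ξ (𝓕 f) := by
  have h := fourierInv_translation ξ (𝓕 f)
  rw [FourierTransform.fourierInv_fourier_eq] at h
  rw [← h, FourierTransform.fourier_fourierInv_eq]

theorem isMetaplectic_fourier (d : ℕ) :
    IsMetaplectic (Matrix.fromBlocks 0 1 (-1) 0) (Lp.fourierTransformₗᵢ (Rd d) ℂ) := by
  refine IsMetaplectic.of_comm fun z t f => ?_
  have hp : pos (Matrix.fromBlocks 0 1 (-1) 0 *ᵥ z) = mom z := by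
    ext i; simp [pos, mom, Matrix.fromBlocks_mulVec, Function.comp_def]
  have hm : mom (Matrix.fromBlocks 0 1 (-1) 0 *ᵥ z) = -pos z := by
    ext i; simp [pos, mom, Matrix.fromBlocks_mulVec, Function.comp_def, Matrix.neg_mulVec]
  rw [schrodinger_eq_modulation_translation (_ *ᵥ z), schrodinger_eq_translation_modulation z,
    map_smul, hp, hm]
  change _ = _ • 𝓕 (translation (pos z) (modulation (mom z) f))
  rw [fourier_translation, fourier_modulation, inner_neg_right, real_inner_comm]
  push_cast
  rw [mul_neg, neg_neg]
  rfl

theorem exists_isMetaplectic_upper {d : ℕ} (X : Matrix (Fin d) (Fin d) ℝ) (hX : X.IsSymm) :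
    ∃ U : L2 d ≃ₗᵢ[ℂ] L2 d, IsMetaplectic (Matrix.fromBlocks 1 X 0 1) U := by
  obtain ⟨U, hU⟩ := exists_isMetaplectic_lower (-X) hX.neg
  have hF := isMetaplectic_fourier d
  have hinv : Matrix.fromBlocks 0 (1 : Matrix (Fin d) (Fin d) ℝ) (-1 : Matrix (Fin d) (Fin d) ℝ) 0 *
      Matrix.fromBlocks 0 (-1 : Matrix (Fin d) (Fin d) ℝ) (1 : Matrix (Fin d) (Fin d) ℝ) 0 =
      (1 : Matrix (Fin d ⊕ Fin d) (Fin d ⊕ Fin d) ℝ) := by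
    simp [Matrix.fromBlocks_multiply]
  have h := hF.mul (hU.mul (hF.inv hinv))
  have e : (Matrix.fromBlocks 1 X 0 1 : Matrix (Fin d ⊕ Fin d) (Fin d ⊕ Fin d) ℝ) =
      Matrix.fromBlocks 0 (1 : Matrix (Fin d) (Fin d) ℝ) (-1 : Matrix (Fin d) (Fin d) ℝ) 0 *
        (Matrix.fromBlocks 1 0 (-X) 1 *
          Matrix.fromBlocks 0 (-1 : Matrix (Fin d) (Fin d) ℝ) (1 : Matrix (Fin d) (Fin d) ℝ) 0) := by
    simp [Matrix.fromBlocks_multiply]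
  rw [e]
  exact ⟨_, h⟩

/-- The upper left block of a symplectic matrix becomes invertible after a shear. -/
theorem exists_det_add_smul_ne_zero {d : ℕ} {A B C D : Matrix (Fin d) (Fin d) ℝ}
    (h : Matrix.fromBlocks A B C D ∈ Matrix.symplecticGroup (Fin d) ℝ) :
    ∃ s : ℝ, (A + s • C).det ≠ 0 := by
  obtain ⟨hAC, -, hAD⟩ := SymplecticGroup.fromBlocks_mem_iff.1 h
  by_contra! hall
  let p : Polynomial ℝ := (A.map Polynomial.C + (Polynomial.X : Polynomial ℝ) • C.map Polynomial.C).det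
  have hp : p = 0 := by
    refine Polynomial.funext fun s => ?_
    rw [Polynomial.eval_zero, ← hall s, ← Polynomial.coe_evalRingHom, RingHom.map_det]
    congr 1
    ext i j
    simp
    ring
  have hdet : (A.map Complex.ofReal + Complex.I • C.map Complex.ofReal).det = 0 := by
    have h0 : Polynomial.eval₂RingHom Complex.ofRealHom Complex.I p = 0 := by rw [hp, map_zero]
    rw [← h0, RingHom.map_det]
    congr 1
    ext i j
    simp
    ring
  obtain ⟨v, hv0, hv⟩ := Matrix.exists_mulVec_eq_zero_iff.2 hdet
  let a : Fin d → ℝ := fun i => (v i).re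
  let b : Fin d → ℝ := fun i => (v i).im
  have e1 : A *ᵥ a = C *ᵥ b := by
    ext i
    have := congrArg Complex.re (congrFun hv i)
    simp only [Matrix.mulVec, dotProduct, Matrix.add_apply, Matrix.map_apply, Matrix.smul_apply,
      smul_eq_mul, Complex.re_sum, Complex.mul_re, Complex.add_re, Complex.add_im,
      Complex.mul_im, Complex.ofReal_re, Complex.ofReal_im, Complex.I_re, Complex.I_im,
      Pi.zero_apply, Complex.zero_re] at this
    simp only [Matrix.mulVec, dotProduct, a, b]
    rw [← sub_eq_zero, ← Finset.sum_sub_distrib, ← this]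
    exact Finset.sum_congr rfl fun j _ => by ring
  have e2 : C *ᵥ a = -(A *ᵥ b) := by
    ext i
    have := congrArg Complex.im (congrFun hv i)
    simp only [Matrix.mulVec, dotProduct, Matrix.add_apply, Matrix.map_apply, Matrix.smul_apply,
      smul_eq_mul, Complex.im_sum, Complex.mul_re, Complex.add_re, Complex.add_im,
      Complex.mul_im, Complex.ofReal_re, Complex.ofReal_im, Complex.I_re, Complex.I_im,
      Pi.zero_apply, Complex.zero_im] at this
    simp only [Pi.neg_apply, Matrix.mulVec, dotProduct, a, b]
    rw [← sub_eq_zero, sub_neg_eq_add, ← Finset.sum_add_distrib, ← this]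
    exact Finset.sum_congr rfl fun j _ => by ring
  have e3 : (A *ᵥ a) ⬝ᵥ (A *ᵥ a) = -((A *ᵥ b) ⬝ᵥ (A *ᵥ b)) := by
    have key : (A *ᵥ a) ⬝ᵥ (C *ᵥ b) = (C *ᵥ a) ⬝ᵥ (A *ᵥ b) := by
      rw [← Matrix.vecMul_transpose A a, ← Matrix.vecMul_transpose C a,
        ← Matrix.dotProduct_mulVec, ← Matrix.dotProduct_mulVec, Matrix.mulVec_mulVec,
        Matrix.mulVec_mulVec, hAC]
    calc (A *ᵥ a) ⬝ᵥ (A *ᵥ a) = (A *ᵥ a) ⬝ᵥ (C *ᵥ b) := by rw [← e1]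
      _ = -((A *ᵥ b) ⬝ᵥ (A *ᵥ b)) := by rw [key, e2, neg_dotProduct]
  have n1 : 0 ≤ (A *ᵥ a) ⬝ᵥ (A *ᵥ a) := by
    simpa using dotProduct_star_self_nonneg (A *ᵥ a)
  have n2 : 0 ≤ (A *ᵥ b) ⬝ᵥ (A *ᵥ b) := by
    simpa using dotProduct_star_self_nonneg (A *ᵥ b)
  have z1 : A *ᵥ a = 0 := dotProduct_self_eq_zero.1 (by linarith)
  have z2 : A *ᵥ b = 0 := dotProduct_self_eq_zero.1 (by linarith)
  have hDA : Dᵀ * A - Bᵀ * C = 1 := by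
    have := congrArg Matrix.transpose hAD
    simpa [Matrix.transpose_sub, Matrix.transpose_mul] using this
  have hz : ∀ u : Fin d → ℝ, A *ᵥ u = 0 → C *ᵥ u = 0 → u = 0 := fun u h1 h2 => by
    rw [← Matrix.one_mulVec u, ← hDA, Matrix.sub_mulVec, ← Matrix.mulVec_mulVec,
      ← Matrix.mulVec_mulVec, h1, h2, Matrix.mulVec_zero, Matrix.mulVec_zero, sub_zero]
  have ha : a = 0 := hz a z1 (by rw [e2, z2, neg_zero])
  have hb : b = 0 := hz b z2 (by rw [← e1, z1])
  exact hv0 (funext fun i => Complex.ext (congrFun ha i) (congrFun hb i))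

theorem exists_isMetaplectic {d : ℕ} (M : Matrix.symplecticGroup (Fin d) ℝ) :
    ∃ U : L2 d ≃ₗᵢ[ℂ] L2 d, IsMetaplectic M.1 U := by
  obtain ⟨M, hM⟩ := M
  obtain ⟨A, B, C, D, rfl⟩ : ∃ A B C D, M = Matrix.fromBlocks A B C D :=
    ⟨_, _, _, _, (Matrix.fromBlocks_toBlocks M).symm⟩
  obtain ⟨s, hs⟩ := exists_det_add_smul_ne_zero hM
  have hM2 : Matrix.fromBlocks (A + s • C) (B + s • D) C D ∈
      Matrix.symplecticGroup (Fin d) ℝ := by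
    have hU : Matrix.fromBlocks 1 (s • (1 : Matrix (Fin d) (Fin d) ℝ)) 0 1 ∈
        Matrix.symplecticGroup (Fin d) ℝ :=
      SymplecticGroup.fromBlocks_mem_iff.2 (by simp)
    have := (Matrix.symplecticGroup (Fin d) ℝ).mul_mem hU hM
    simpa [Matrix.fromBlocks_multiply] using this
  obtain ⟨h1, h2, h3⟩ := SymplecticGroup.fromBlocks_mem_iff.1 hM2
  set A' := A + s • C with hA'
  set B' := B + s • D with hB'
  have hu : IsUnit A'.det := isUnit_iff_ne_zero.2 hs
  have hPQ : A' * A'⁻¹ = 1 := Matrix.mul_nonsing_inv _ hu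
  have hQP : A'⁻¹ * A' = 1 := Matrix.nonsing_inv_mul _ hu
  have hT1 : A'ᵀ * A'⁻¹ᵀ = 1 := by rw [← Matrix.transpose_mul, hQP, Matrix.transpose_one]
  have hT2 : A'⁻¹ᵀ * A'ᵀ = 1 := by rw [← Matrix.transpose_mul, hPQ, Matrix.transpose_one]
  have hS' : A'⁻¹ᵀ * Cᵀ = C * A'⁻¹ := by
    calc A'⁻¹ᵀ * Cᵀ = A'⁻¹ᵀ * (Cᵀ * A') * A'⁻¹ := by
          rw [Matrix.mul_assoc, Matrix.mul_assoc, hPQ, Matrix.mul_one]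
      _ = (A'⁻¹ᵀ * A'ᵀ) * (C * A'⁻¹) := by rw [← h1]; simp only [Matrix.mul_assoc]
      _ = C * A'⁻¹ := by rw [hT2, Matrix.one_mul]
  have hS : (C * A'⁻¹).IsSymm := by
    rw [Matrix.IsSymm, Matrix.transpose_mul, hS']
  have hX : (A'⁻¹ * B').IsSymm := by
    have hBA : A' * B'ᵀ = B' * A'ᵀ := by
      have ht := SymplecticGroup.transpose_mem hM2
      rw [Matrix.fromBlocks_transpose] at ht
      simpa using (SymplecticGroup.fromBlocks_mem_iff.1 ht).1
    rw [Matrix.IsSymm, Matrix.transpose_mul]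
    calc B'ᵀ * A'⁻¹ᵀ = A'⁻¹ * (A' * B'ᵀ) * A'⁻¹ᵀ := by
          rw [← Matrix.mul_assoc, hQP, Matrix.one_mul]
      _ = A'⁻¹ * B' * (A'ᵀ * A'⁻¹ᵀ) := by rw [hBA]; simp only [Matrix.mul_assoc]
      _ = A'⁻¹ * B' := by rw [hT1, Matrix.mul_one]
  have hD : C * (A'⁻¹ * B') + A'⁻¹ᵀ = D := by
    calc C * (A'⁻¹ * B') + A'⁻¹ᵀ = A'⁻¹ᵀ * (Cᵀ * B' + 1) := by
          rw [Matrix.mul_add A'⁻¹ᵀ (Cᵀ * B') 1, Matrix.mul_one, ← Matrix.mul_assoc A'⁻¹ᵀ, hS',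
            Matrix.mul_assoc]
      _ = A'⁻¹ᵀ * (A'ᵀ * D) := by rw [← h3]; simp
      _ = D := by rw [← Matrix.mul_assoc, hT2, Matrix.one_mul]
  obtain ⟨U1, hU1⟩ := exists_isMetaplectic_upper (-(s • (1 : Matrix (Fin d) (Fin d) ℝ)))
    ((Matrix.isSymm_one.smul s).neg)
  obtain ⟨U2, hU2⟩ := exists_isMetaplectic_lower (C * A'⁻¹) hS
  obtain ⟨U3, hU3⟩ := exists_isMetaplectic_diag A' A'⁻¹ hPQ
  obtain ⟨U4, hU4⟩ := exists_isMetaplectic_upper (A'⁻¹ * B') hX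
  have e : Matrix.fromBlocks A B C D =
      Matrix.fromBlocks 1 (-(s • (1 : Matrix (Fin d) (Fin d) ℝ))) 0 1 *
        (Matrix.fromBlocks 1 0 (C * A'⁻¹) 1 * (Matrix.fromBlocks A' 0 0 A'⁻¹ᵀ *
          Matrix.fromBlocks 1 (A'⁻¹ * B') 0 1)) := by
    have c1 : A' * (A'⁻¹ * B') = B' := by rw [← Matrix.mul_assoc, hPQ, Matrix.one_mul]
    have c2 : C * A'⁻¹ * A' = C := by rw [Matrix.mul_assoc, hQP, Matrix.mul_one]
    have c3 : C * A'⁻¹ * B' + A'⁻¹ᵀ = D := by rw [Matrix.mul_assoc, hD]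
    simp only [Matrix.fromBlocks_multiply, Matrix.mul_zero, Matrix.zero_mul, Matrix.mul_one,
      Matrix.one_mul, add_zero, zero_add, c1, c2, c3, Matrix.neg_mul, Matrix.smul_mul]
    simp [hA', hB']
  change ∃ U, IsMetaplectic (Matrix.fromBlocks A B C D) U
  rw [e]
  exact ⟨_, hU1.mul (hU2.mul (hU3.mul hU4))⟩

/-- The metaplectic operator `μ(A)`, for `A ∈ Sp(d, ℝ)`: a unitary operator of `L²(ℝᵈ)` with
`ρ(Az, t) = μ(A) ∘ ρ(z, t) ∘ μ(A)⁻¹` for all `(z, t)`. It is determined up to a phase factor, and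
a phase is chosen for each `A`; all notions below are insensitive to that choice. -/
def metaplectic {d : ℕ} (A : Matrix.symplecticGroup (Fin d) ℝ) : L2 d ≃ₗᵢ[ℂ] L2 d :=
  Classical.choose (exists_isMetaplectic A)

theorem isMetaplectic_metaplectic {d : ℕ} (A : Matrix.symplecticGroup (Fin d) ℝ) :
    IsMetaplectic A.1 (metaplectic A) :=
  Classical.choose_spec (exists_isMetaplectic A)

/-- The set underlying the semidirect product `G = ℝ²ᵈ ⋊ Sp(d, ℝ)`. -/
@[ext]
structure PhaseGroup (d : ℕ) where
  /-- The translation part `z = (q, p) ∈ ℝ²ᵈ`. -/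
  vec : Phase d
  /-- The symplectic part. -/
  lin : Matrix.symplecticGroup (Fin d) ℝ

/-- The group law `(z, A)(z', A') = (z + Az', AA')`. -/
instance PhaseGroup.instGroup (d : ℕ) : Group (PhaseGroup d) where
  mul g h := ⟨g.vec + g.lin.1 *ᵥ h.vec, g.lin * h.lin⟩
  one := ⟨0, 1⟩
  inv g := ⟨-(g.lin⁻¹.1 *ᵥ g.vec), g.lin⁻¹⟩
  mul_assoc a b c := by
    refine PhaseGroup.ext ?_ (mul_assoc _ _ _)
    change a.vec + a.lin.1 *ᵥ b.vec + (a.lin.1 * b.lin.1) *ᵥ c.vec =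
      a.vec + a.lin.1 *ᵥ (b.vec + b.lin.1 *ᵥ c.vec)
    rw [Matrix.mulVec_add, Matrix.mulVec_mulVec, add_assoc]
  one_mul a := by
    refine PhaseGroup.ext ?_ (one_mul _)
    change 0 + (1 : Matrix (Fin d ⊕ Fin d) (Fin d ⊕ Fin d) ℝ) *ᵥ a.vec = a.vec
    rw [Matrix.one_mulVec, zero_add]
  mul_one a := by
    refine PhaseGroup.ext ?_ (mul_one _)
    change a.vec + a.lin.1 *ᵥ 0 = a.vec
    rw [Matrix.mulVec_zero, add_zero]
  inv_mul_cancel a := by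
    refine PhaseGroup.ext ?_ (inv_mul_cancel _)
    change -(a.lin⁻¹.1 *ᵥ a.vec) + a.lin⁻¹.1 *ᵥ a.vec = 0
    exact neg_add_cancel _

/-- The topology of `G`, as a subset of `ℝ²ᵈ × ℝ^{2d × 2d}`. -/
instance PhaseGroup.instTopologicalSpace (d : ℕ) : TopologicalSpace (PhaseGroup d) :=
  TopologicalSpace.induced
    (fun g => ((g.vec, g.lin.1) : Phase d × Matrix (Fin d ⊕ Fin d) (Fin d ⊕ Fin d) ℝ))
    inferInstance

/-- The extended metaplectic representation `μₑ(z, A) = ρ(z, 0) ∘ μ(A)` of `G = ℝ²ᵈ ⋊ Sp(d, ℝ)`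
(a representation up to phase factors). -/
def extMetaplectic {d : ℕ} (g : PhaseGroup d) (φ : L2 d) : L2 d :=
  schrodinger g.vec 0 (metaplectic g.lin φ)

/-- The Wigner distribution
`W_f(x, ξ) = ∫ e^{-2πi⟨ξ,y⟩} f(x + y/2) conj (f(x - y/2)) dy`. -/
def wigner {d : ℕ} (f : Rd d → ℂ) (w : Rd d × Rd d) : ℂ :=
  ∫ y : Rd d, Complex.exp (-(2 * Real.pi * Complex.I * (inner ℝ w.2 y : ℝ))) *
    f (w.1 + (2⁻¹ : ℝ) • y) * conj (f (w.1 - (2⁻¹ : ℝ) • y))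

/-- The space `V`: finite complex linear combinations of the Wigner distributions of Schwartz
functions. -/
def wignerSpan (d : ℕ) : Submodule ℂ (Rd d × Rd d → ℂ) :=
  Submodule.span ℂ (Set.range fun f : 𝓢(Rd d, ℂ) => wigner (f : Rd d → ℂ))

/-- The pairing `⟨F, G⟩ = ∫ F conj(G)` over the phase space `ℝ²ᵈ` with Lebesgue measure. -/
def phasePairing {d : ℕ} (F G : Rd d × Rd d → ℂ) : ℂ :=
  ∫ w : Rd d × Rd d, F w * conj (G w)

section Subgroup

variable {d : ℕ} {H : Type*} [Group H] [MeasurableSpace H]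

/-- The condition `∫_H ⟨W_{μₑ(h)φ}, F⟩ dh = ⟨1, F⟩` for all `F ∈ V`, including that the left-hand
side is well-defined. The group `H` is viewed in `G` through `ι`, and `dh` is the measure `ν`. -/
def IsWeaklyAdmissibleWindow (ι : H →* PhaseGroup d) (ν : Measure H) (φ : L2 d) : Prop :=
  ∀ F ∈ wignerSpan d,
    Integrable (fun h => phasePairing (wigner (extMetaplectic (ι h) φ : Rd d → ℂ)) F) ν ∧
      ∫ h, phasePairing (wigner (extMetaplectic (ι h) φ : Rd d → ℂ)) F ∂ν =
        phasePairing (fun _ => 1) F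

/-- `H` is weakly admissible. -/
def IsWeaklyAdmissible (ι : H →* PhaseGroup d) (ν : Measure H) : Prop :=
  ∃ φ : L2 d, IsWeaklyAdmissibleWindow ι ν φ

/-- `φ` is a reproducing function: `f = ∫_H ⟨f, μₑ(h)φ⟩ μₑ(h)φ dh` holds weakly for all
`f ∈ L²(ℝᵈ)`, that is, `⟨f, g⟩ = ∫_H ⟨f, μₑ(h)φ⟩ ⟨μₑ(h)φ, g⟩ dh` for all `f` and `g`, the integrals
being absolutely convergent. The scalar product `⟨f, g⟩`, linear in `f`, is `inner ℂ g f`. -/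
def IsReproducingFunction (ι : H →* PhaseGroup d) (ν : Measure H) (φ : L2 d) : Prop :=
  ∀ f g : L2 d,
    Integrable (fun h => inner ℂ (extMetaplectic (ι h) φ) f *
      inner ℂ g (extMetaplectic (ι h) φ)) ν ∧
      ∫ h, inner ℂ (extMetaplectic (ι h) φ) f * inner ℂ g (extMetaplectic (ι h) φ) ∂ν =
        inner ℂ g f

/-- `H` is reproducing. -/
def IsReproducing (ι : H →* PhaseGroup d) (ν : Measure H) : Prop :=
  ∃ φ : L2 d, IsReproducingFunction ι ν φ

end Subgroup

end PhaseSpace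

end

noncomputable section

namespace PhaseSpace

/-! ### Rapid decay of cross-Wigner transforms of Schwartz functions. -/

section CrossWigner

open scoped LineDeriv

variable {E : Type*} [NormedAddCommGroup E] [InnerProductSpace ℝ E]

/-! Both conditions say that the vectors `u h = μₑ(h)φ` form a continuous Parseval frame; they
differ only in the vectors on which this is tested.

For `u ∈ L²` and Schwartz `g`, Moyal's identity gives `⟨W_u, W_g⟩ = |⟨u, g⟩|²`, and the marginal
property gives `⟨1, W_g⟩ = ‖g‖²` (`phasePairing_wigner_wigner`, `phasePairing_one_wigner`). Since
both sides of (*) are conjugate linear in `F`, (*) amounts to `∫ |⟨u h, g⟩|² dh = ‖g‖²` for all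
Schwartz `g` (`isWeaklyAdmissibleWindow_iff_norm_sq`). By polarization, the reproducing property is
the same identity for all `g ∈ L²` (`isReproducingFunction_iff_norm_sq`).

What remains is to pass from a dense set to the whole space. Fatou's lemma gives the upper bound,
and the parallelogram law turns it into equality (`integral_norm_inner_sq_of_dense`).

The analytic cost lies in making the pairings absolutely convergent: `W_u` is only bounded, so `W_g`
has to be integrable over phase space. This follows from its rapid decay, proved by induction on the
power of the weight. -/

theorem antilipschitzWith_sub_half_smul (x : E) :
    AntilipschitzWith 2 fun y : E => x - (2⁻¹ : ℝ) • y := by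
  refine AntilipschitzWith.of_le_mul_dist fun y z => ?_
  rw [dist_sub_left, dist_smul₀, Real.norm_of_nonneg (by norm_num), NNReal.coe_ofNat]
  linarith

theorem hasTemperateGrowth_sub_half_smul (x : E) :
    Function.HasTemperateGrowth fun y : E => x - (2⁻¹ : ℝ) • y :=
  (Function.HasTemperateGrowth.const x).sub
    ((2⁻¹ : ℝ) • ContinuousLinearMap.id ℝ E).hasTemperateGrowth

theorem hasTemperateGrowth_add_half_smul (x : E) :
    Function.HasTemperateGrowth fun y : E => x + (2⁻¹ : ℝ) • y :=
  (Function.HasTemperateGrowth.const x).add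
    ((2⁻¹ : ℝ) • ContinuousLinearMap.id ℝ E).hasTemperateGrowth

/-- The Schwartz function `y ↦ f(x + y/2) g(x - y/2)`. -/
def slice (f g : 𝓢(E, ℂ)) (x : E) : 𝓢(E, ℂ) :=
  SchwartzMap.smulLeftCLM ℂ (fun y => f (x + (2⁻¹ : ℝ) • y))
    (SchwartzMap.compCLMOfAntilipschitz ℂ (hasTemperateGrowth_sub_half_smul x)
      (antilipschitzWith_sub_half_smul x) g)

theorem slice_apply (f g : 𝓢(E, ℂ)) (x y : E) :
    slice f g x y = f (x + (2⁻¹ : ℝ) • y) * g (x - (2⁻¹ : ℝ) • y) := by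
  have h := f.hasTemperateGrowth.comp (hasTemperateGrowth_add_half_smul x)
  exact SchwartzMap.smulLeftCLM_apply_apply h _ y

/-- The Fourier transform in `y` turns `∂_v` into multiplication by `2πi⟨ξ, v⟩`, so a factor `⟨ξ,
v⟩` on the cross-Wigner transform is traded for a derivative of `f` or of `g`. -/
theorem lineDeriv_slice (f g : 𝓢(E, ℂ)) (x v : E) :
    ∂_{v} (slice f g x) = (2⁻¹ : ℂ) • (slice (∂_{v} f) g x - slice f (∂_{v} g) x) := by
  ext y
  have h1 : HasFDerivAt (fun y : E => x + (2⁻¹ : ℝ) • y)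
      ((2⁻¹ : ℝ) • ContinuousLinearMap.id ℝ E) y :=
    ((hasFDerivAt_id y).const_smul (2⁻¹ : ℝ)).const_add x
  have h2 : HasFDerivAt (fun y : E => x - (2⁻¹ : ℝ) • y)
      (-((2⁻¹ : ℝ) • ContinuousLinearMap.id ℝ E)) y :=
    ((hasFDerivAt_id y).const_smul (2⁻¹ : ℝ)).const_sub x
  have h3 := ((f.hasFDerivAt _).comp y h1).mul ((g.hasFDerivAt _).comp y h2)
  have h4 : HasFDerivAt (slice f g x) _ y :=
    h3.congr_of_eventuallyEq (Filter.Eventually.of_forall fun z => slice_apply f g x z)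
  rw [SchwartzMap.lineDerivOp_apply_eq_fderiv, h4.fderiv]
  simp only [_root_.smul_apply, _root_.sub_apply, slice_apply,
    SchwartzMap.lineDerivOp_apply_eq_fderiv]
  simp
  ring

/-- Multiplication of a Schwartz function by the linear functional `⟨·, v⟩`. -/
def mulInner (v : E) (f : 𝓢(E, ℂ)) : 𝓢(E, ℂ) :=
  SchwartzMap.smulLeftCLM ℂ (fun x => inner ℝ x v) f

theorem mulInner_apply (v : E) (f : 𝓢(E, ℂ)) (x : E) :
    mulInner v f x = (inner ℝ x v : ℝ) * f x := by
  rw [mulInner, SchwartzMap.smulLeftCLM_apply_apply (by fun_prop)]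
  simp

/-- Because `2x = (x + y/2) + (x - y/2)`, a factor `⟨x, v⟩` can be moved onto `f` and `g`. -/
theorem slice_mulInner (f g : 𝓢(E, ℂ)) (x v : E) :
    slice (mulInner v f) g x + slice f (mulInner v g) x =
      ((2 * inner ℝ x v : ℝ) : ℂ) • slice f g x := by
  ext y
  simp only [_root_.add_apply, slice_apply, mulInner_apply, _root_.smul_apply,
    inner_add_left, inner_sub_left, smul_eq_mul]
  push_cast
  ring

theorem norm_le_sum_abs_inner {ι : Type*} [Fintype ι] (b : OrthonormalBasis ι ℝ E) (x : E) :
    ‖x‖ ≤ ∑ i, |inner ℝ x (b i)| := by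
  conv_lhs => rw [← b.sum_repr' x]
  refine (norm_sum_le _ _).trans (Finset.sum_le_sum fun i _ => ?_)
  rw [norm_smul, b.norm_eq_one, mul_one, Real.norm_eq_abs, real_inner_comm]

variable [FiniteDimensional ℝ E] [MeasurableSpace E] [BorelSpace E]

theorem norm_fourier_slice_le (f g : 𝓢(E, ℂ)) :
    ∃ C, ∀ x ξ, ‖𝓕 (slice f g x) ξ‖ ≤ C := by
  obtain ⟨C, hC0, hC⟩ := f.decay 0 0
  simp only [pow_zero, one_mul, norm_iteratedFDeriv_zero] at hC
  -- The sup norm of `f` times the `L¹` norm of the rescaled `g`; the shift by `2x` in the argument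
  -- of `g` does not affect the integral, so the bound is uniform in `x`.
  refine ⟨C * ∫ y, ‖g (-((2⁻¹ : ℝ) • y))‖, fun x ξ => ?_⟩
  have h1 : ‖𝓕 (slice f g x) ξ‖ ≤ ∫ y, ‖slice f g x y‖ := by
    rw [SchwartzMap.fourier_coe]
    exact VectorFourier.norm_fourierIntegral_le_integral_norm _ _ _ _ _
  refine h1.trans ?_
  have hg : Integrable (fun y => ‖g (-((2⁻¹ : ℝ) • y))‖) := by
    have := (g.integrable (μ := volume)).comp_smul (R := -2⁻¹) (by norm_num)
    simpa using this.norm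
  have hg' := hg.comp_sub_right ((2 : ℝ) • x)
  rw [← integral_sub_right_eq_self (fun y => ‖g (-((2⁻¹ : ℝ) • y))‖) ((2 : ℝ) • x),
    ← integral_const_mul]
  refine integral_mono (slice f g x).integrable.norm (hg'.const_mul C) fun y => ?_
  have e : -((2⁻¹ : ℝ) • (y - (2 : ℝ) • x)) = x - (2⁻¹ : ℝ) • y := by
    rw [smul_sub, smul_smul]; norm_num
  simp only [slice_apply, norm_mul, e]
  gcongr
  exact hC _

/-- Cross-Wigner distributions of Schwartz functions decay rapidly in the space variable. -/
theorem exists_pow_mul_norm_fourier_slice_le (n : ℕ) (f g : 𝓢(E, ℂ)) :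
    ∃ C, ∀ x ξ, (1 + ‖x‖) ^ n * ‖𝓕 (slice f g x) ξ‖ ≤ C := by
  -- Each step replaces one of the two functions by its product with a coordinate. This leaves the
  -- diagonal `(g, conj g)`, which is why arbitrary pairs are treated.
  induction n generalizing f g with
  | zero => simpa using norm_fourier_slice_le f g
  | succ n ih =>
    let b := stdOrthonormalBasis ℝ E
    choose C₁ h₁ using fun i => ih (mulInner (b i) f) g
    choose C₂ h₂ using fun i => ih f (mulInner (b i) g)
    obtain ⟨C₀, h₀⟩ := ih f g
    refine ⟨C₀ + ∑ i, (C₁ i + C₂ i), fun x ξ => ?_⟩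
    have key : ∀ i, (1 + ‖x‖) ^ n * (|inner ℝ x (b i)| * ‖𝓕 (slice f g x) ξ‖) ≤ C₁ i + C₂ i := by
      intro i
      have e := congrArg (fun F : 𝓢(E, ℂ) => ‖𝓕 F ξ‖) (slice_mulInner f g x (b i))
      simp only [FourierTransform.fourier_add, FourierTransform.fourier_smul,
        _root_.add_apply, _root_.smul_apply, norm_smul, Complex.norm_real,
        Real.norm_eq_abs, abs_mul] at e
      have h3 := norm_add_le (𝓕 (slice (mulInner (b i) f) g x) ξ)
        (𝓕 (slice f (mulInner (b i) g) x) ξ)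
      have h4 : |inner ℝ x (b i)| * ‖𝓕 (slice f g x) ξ‖ ≤
          ‖𝓕 (slice (mulInner (b i) f) g x) ξ‖ + ‖𝓕 (slice f (mulInner (b i) g) x) ξ‖ := by
        rw [abs_two] at e
        nlinarith [mul_nonneg (abs_nonneg (inner ℝ x (b i))) (norm_nonneg (𝓕 (slice f g x) ξ))]
      calc _ ≤ (1 + ‖x‖) ^ n * (‖𝓕 (slice (mulInner (b i) f) g x) ξ‖ +
            ‖𝓕 (slice f (mulInner (b i) g) x) ξ‖) := by gcongr
        _ ≤ _ := by rw [mul_add]; exact add_le_add (h₁ i x ξ) (h₂ i x ξ)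
    calc (1 + ‖x‖) ^ (n + 1) * ‖𝓕 (slice f g x) ξ‖
        = (1 + ‖x‖) ^ n * ‖𝓕 (slice f g x) ξ‖ +
          (1 + ‖x‖) ^ n * (‖x‖ * ‖𝓕 (slice f g x) ξ‖) := by ring
      _ ≤ C₀ + (1 + ‖x‖) ^ n * ((∑ i, |inner ℝ x (b i)|) * ‖𝓕 (slice f g x) ξ‖) := by
          gcongr
          · exact h₀ x ξ
          · exact norm_le_sum_abs_inner b x
      _ ≤ _ := by
          rw [Finset.sum_mul, Finset.mul_sum]
          gcongr with i
          exact key i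

/-- Cross-Wigner distributions of Schwartz functions decay rapidly. -/
theorem exists_pow_mul_pow_mul_norm_fourier_slice_le (n m : ℕ) (f g : 𝓢(E, ℂ)) :
    ∃ C, ∀ x ξ, (1 + ‖x‖) ^ n * (1 + ‖ξ‖) ^ m * ‖𝓕 (slice f g x) ξ‖ ≤ C := by
  induction m generalizing f g with
  | zero => simpa using exists_pow_mul_norm_fourier_slice_le n f g
  | succ m ih =>
    let b := stdOrthonormalBasis ℝ E
    choose C₁ h₁ using fun i => ih (∂_{b i} f) g
    choose C₂ h₂ using fun i => ih f (∂_{b i} g)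
    obtain ⟨C₀, h₀⟩ := ih f g
    refine ⟨C₀ + ∑ i, (C₁ i + C₂ i), fun x ξ => ?_⟩
    have key : ∀ i, (1 + ‖x‖) ^ n * (1 + ‖ξ‖) ^ m *
        (|inner ℝ ξ (b i)| * ‖𝓕 (slice f g x) ξ‖) ≤ C₁ i + C₂ i := by
      intro i
      have e := congrArg (fun F : 𝓢(E, ℂ) => ‖𝓕 F ξ‖) (lineDeriv_slice f g x (b i))
      simp only [SchwartzMap.fourier_lineDerivOp_eq, FourierTransform.fourier_smul,
        sub_eq_add_neg, FourierTransform.fourier_add, FourierTransform.fourier_neg,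
        _root_.add_apply, _root_.neg_apply, _root_.smul_apply, norm_smul] at e
      rw [SchwartzMap.smulLeftCLM_apply_apply (by fun_prop), norm_smul] at e
      have h3 := norm_sub_le (𝓕 (slice (∂_{b i} f) g x) ξ) (𝓕 (slice f (∂_{b i} g) x) ξ)
      rw [sub_eq_add_neg] at h3
      have e2 : ‖(2 * (Real.pi : ℂ) * Complex.I)‖ = 2 * Real.pi := by
        simp [abs_of_pos Real.pi_pos]
      have e3 : ‖(2⁻¹ : ℂ)‖ = 2⁻¹ := by simp
      rw [e2, e3, Real.norm_eq_abs] at e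
      -- The identity `e` has the factor `2π` on the left and `1/2` on the right, so there is room
      -- to spare.
      have h4 : |inner ℝ ξ (b i)| * ‖𝓕 (slice f g x) ξ‖ ≤
          ‖𝓕 (slice (∂_{b i} f) g x) ξ‖ + ‖𝓕 (slice f (∂_{b i} g) x) ξ‖ := by
        nlinarith [mul_nonneg (abs_nonneg (inner ℝ ξ (b i))) (norm_nonneg (𝓕 (slice f g x) ξ)),
          Real.pi_gt_three]
      calc _ ≤ (1 + ‖x‖) ^ n * (1 + ‖ξ‖) ^ m * (‖𝓕 (slice (∂_{b i} f) g x) ξ‖ +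
            ‖𝓕 (slice f (∂_{b i} g) x) ξ‖) := by gcongr
        _ ≤ _ := by rw [mul_add]; exact add_le_add (h₁ i x ξ) (h₂ i x ξ)
    calc (1 + ‖x‖) ^ n * (1 + ‖ξ‖) ^ (m + 1) * ‖𝓕 (slice f g x) ξ‖
        = (1 + ‖x‖) ^ n * (1 + ‖ξ‖) ^ m * ‖𝓕 (slice f g x) ξ‖ +
          (1 + ‖x‖) ^ n * (1 + ‖ξ‖) ^ m * (‖ξ‖ * ‖𝓕 (slice f g x) ξ‖) := by ring
      _ ≤ C₀ + (1 + ‖x‖) ^ n * (1 + ‖ξ‖) ^ m *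
          ((∑ i, |inner ℝ ξ (b i)|) * ‖𝓕 (slice f g x) ξ‖) := by
          gcongr
          · exact h₀ x ξ
          · exact norm_le_sum_abs_inner b ξ
      _ ≤ _ := by
          rw [Finset.sum_mul, Finset.mul_sum]
          gcongr with i
          exact key i

/-- Cross-Wigner distributions of Schwartz functions are integrable over phase space. -/
theorem integrable_fourier_slice (f g : 𝓢(E, ℂ))
    (hm : AEStronglyMeasurable (fun w : E × E => 𝓕 (slice f g w.1) w.2) volume) :
    Integrable (fun w : E × E => 𝓕 (slice f g w.1) w.2) := by
  -- An exponent above the dimension makes `(1 + ‖x‖)^(-n)` integrable over `E`; it is used once for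
  -- `x` and once for `ξ`.
  set n := Module.finrank ℝ E + 1
  obtain ⟨C, hC⟩ := exists_pow_mul_pow_mul_norm_fourier_slice_le n n f g
  have h1 : Integrable (fun x : E => (1 + ‖x‖) ^ (-(n : ℝ))) :=
    integrable_one_add_norm (by simp [n])
  refine ((h1.mul_prod h1).const_mul C).mono' hm (Filter.Eventually.of_forall fun w => ?_)
  have := hC w.1 w.2
  rw [Real.rpow_neg (by positivity), Real.rpow_neg (by positivity), Real.rpow_natCast,
    Real.rpow_natCast, ← mul_inv, ← div_eq_mul_inv, le_div_iff₀ (by positivity), mul_comm]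
  exact this

end CrossWigner

/-! ### Moyal's identity and the total integral of the Wigner distribution. -/

section Moyal

variable {d : ℕ}

theorem wigner_eq_fourier (f : Rd d → ℂ) (w : Rd d × Rd d) :
    wigner f w =
      𝓕 (fun y => f (w.1 + (2⁻¹ : ℝ) • y) * conj (f (w.1 - (2⁻¹ : ℝ) • y))) w.2 := by
  rw [Real.fourier_eq, wigner]
  congr 1 with y
  rw [Circle.smul_def, Real.fourierChar_apply, real_inner_comm w.2 y, smul_eq_mul, mul_assoc]
  congr 2
  push_cast
  ring

/-- The complex conjugate of a Schwartz function. -/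
def conjSchwartz (g : 𝓢(Rd d, ℂ)) : 𝓢(Rd d, ℂ) :=
  g.postcompCLM (𝕜 := ℝ) (Complex.conjCLE : ℂ →L[ℝ] ℂ)

theorem conjSchwartz_apply (g : 𝓢(Rd d, ℂ)) (x : Rd d) : conjSchwartz g x = conj (g x) := rfl

theorem wigner_schwartz (g : 𝓢(Rd d, ℂ)) (w : Rd d × Rd d) :
    wigner g w = 𝓕 (slice g (conjSchwartz g) w.1) w.2 := by
  rw [wigner_eq_fourier, SchwartzMap.fourier_coe]
  refine congrArg (fun F : Rd d → ℂ => 𝓕 F w.2) (funext fun y => ?_)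
  rw [slice_apply, conjSchwartz_apply]

theorem stronglyMeasurable_wigner {f : Rd d → ℂ} (hf : StronglyMeasurable f) :
    StronglyMeasurable (wigner f) := by
  refine StronglyMeasurable.integral_prod_right (f := fun (w : Rd d × Rd d) (y : Rd d) =>
    Complex.exp (-(2 * Real.pi * Complex.I * (inner ℝ w.2 y : ℝ))) *
      f (w.1 + (2⁻¹ : ℝ) • y) * conj (f (w.1 - (2⁻¹ : ℝ) • y))) ?_
  refine StronglyMeasurable.mul (StronglyMeasurable.mul ?_ ?_) ?_
  · refine Continuous.stronglyMeasurable ?_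
    fun_prop
  · exact hf.comp_measurable (g := fun p : (Rd d × Rd d) × Rd d => p.1.1 + (2⁻¹ : ℝ) • p.2)
      (by fun_prop)
  · exact Complex.continuous_conj.comp_stronglyMeasurable
      (hf.comp_measurable (g := fun p : (Rd d × Rd d) × Rd d => p.1.1 - (2⁻¹ : ℝ) • p.2)
        (by fun_prop))

/-- Domination comes from rapid decay; joint measurability in `(x, ξ)` comes from the general
statement on integrals depending on a parameter. -/
theorem integrable_wigner_schwartz (g : 𝓢(Rd d, ℂ)) : Integrable (wigner (g : Rd d → ℂ)) := by
  have e : wigner (g : Rd d → ℂ) = fun w => 𝓕 (slice g (conjSchwartz g) w.1) w.2 :=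
    funext (wigner_schwartz g)
  have hm := (stronglyMeasurable_wigner g.continuous.stronglyMeasurable).aestronglyMeasurable
    (μ := volume)
  rw [e] at hm ⊢
  exact integrable_fourier_slice _ _ hm

/-- As `x + y/2 = (y + 2x)/2`, the dependence on `x` is a translation in `y`. This makes the later
bounds uniform in `x`. -/
theorem integrable_half_smul {F : Rd d → ℝ} (hF : Integrable F) (x : Rd d) :
    Integrable (fun y => F (x + (2⁻¹ : ℝ) • y)) ∧
      ∫ y, F (x + (2⁻¹ : ℝ) • y) = ∫ y, F ((2⁻¹ : ℝ) • y) := by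
  have h := hF.comp_smul (R := 2⁻¹) (by norm_num)
  have e : (fun y => F (x + (2⁻¹ : ℝ) • y)) = fun y => F ((2⁻¹ : ℝ) • (y + (2 : ℝ) • x)) := by
    ext y
    rw [smul_add, smul_smul, add_comm]
    norm_num
  rw [e]
  exact ⟨h.comp_add_right _, integral_add_right_eq_self (fun y => F ((2⁻¹ : ℝ) • y)) _⟩

theorem integrable_sub_half_smul {F : Rd d → ℝ} (hF : Integrable F) (x : Rd d) :
    Integrable (fun y => F (x - (2⁻¹ : ℝ) • y)) ∧
      ∫ y, F (x - (2⁻¹ : ℝ) • y) = ∫ y, F ((2⁻¹ : ℝ) • y) := by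
  have e : (fun y => F (x - (2⁻¹ : ℝ) • y)) = fun y => F (x + (2⁻¹ : ℝ) • -y) := by
    ext y
    rw [smul_neg, sub_eq_add_neg]
  obtain ⟨h1, h2⟩ := integrable_half_smul hF x
  rw [e]
  exact ⟨h1.comp_neg, by rw [← h2, integral_neg_eq_self (fun y => F (x + (2⁻¹ : ℝ) • y))]⟩

variable {f : Rd d → ℂ}

/-- Follows from `ab ≤ (a² + b²)/2`, where both squares have the same integral, independent of `x`.
-/
theorem integrable_wigner_integrand (hf : StronglyMeasurable f) (hf2 : MemLp f 2 volume)
    (x : Rd d) :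
    Integrable (fun y => f (x + (2⁻¹ : ℝ) • y) * conj (f (x - (2⁻¹ : ℝ) • y))) ∧
      ∫ y, ‖f (x + (2⁻¹ : ℝ) • y) * conj (f (x - (2⁻¹ : ℝ) • y))‖ ≤
        ∫ y, ‖f ((2⁻¹ : ℝ) • y)‖ ^ 2 := by
  have hF : Integrable (fun y => ‖f y‖ ^ 2) := hf2.integrable_norm_pow (by norm_num)
  obtain ⟨h1, e1⟩ := integrable_half_smul hF x
  obtain ⟨h2, e2⟩ := integrable_sub_half_smul hF x
  have h3 := (h1.add h2).const_mul 2⁻¹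
  have hle : ∀ y, ‖f (x + (2⁻¹ : ℝ) • y) * conj (f (x - (2⁻¹ : ℝ) • y))‖ ≤
      2⁻¹ * (‖f (x + (2⁻¹ : ℝ) • y)‖ ^ 2 + ‖f (x - (2⁻¹ : ℝ) • y)‖ ^ 2) := fun y => by
    rw [norm_mul, RCLike.norm_conj]
    nlinarith [sq_nonneg (‖f (x + (2⁻¹ : ℝ) • y)‖ - ‖f (x - (2⁻¹ : ℝ) • y)‖)]
  have hm : AEStronglyMeasurable
      (fun y => f (x + (2⁻¹ : ℝ) • y) * conj (f (x - (2⁻¹ : ℝ) • y))) volume :=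
    ((hf.comp_measurable (by fun_prop)).mul (Complex.continuous_conj.comp_stronglyMeasurable
      (hf.comp_measurable (by fun_prop)))).aestronglyMeasurable
  have hi := h3.mono' hm (Filter.Eventually.of_forall hle)
  refine ⟨hi, (integral_mono hi.norm h3 hle).trans (le_of_eq ?_)⟩
  simp only [Pi.add_apply]
  rw [integral_const_mul, integral_add h1 h2, e1, e2]
  ring

theorem norm_wigner_le (hf : StronglyMeasurable f) (hf2 : MemLp f 2 volume)
    (w : Rd d × Rd d) : ‖wigner f w‖ ≤ ∫ y, ‖f ((2⁻¹ : ℝ) • y)‖ ^ 2 := by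
  rw [wigner_eq_fourier]
  exact (VectorFourier.norm_fourierIntegral_le_integral_norm _ _ _ _ _).trans
    (integrable_wigner_integrand hf hf2 w.1).2

theorem integrable_wigner_mul_conj (hf : StronglyMeasurable f) (hf2 : MemLp f 2 volume)
    {F : Rd d × Rd d → ℂ} (hF : Integrable F) : Integrable fun w => wigner f w * conj (F w) :=
  (Complex.conjLIE.integrable_comp_iff.2 hF).bdd_mul
    (stronglyMeasurable_wigner hf).aestronglyMeasurable
    (Filter.Eventually.of_forall (norm_wigner_le hf hf2))

/-- The map is the shear `(x, y) ↦ (x + y/2, y)` followed by `(u, y) ↦ (u, u - y)`. Each alters one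
coordinate by a measure-preserving map depending on the other; the swaps only bring the shear into
skew-product form. -/
theorem measurePreserving_add_half_sub_half :
    MeasurePreserving (fun p : Rd d × Rd d =>
      (p.1 + (2⁻¹ : ℝ) • p.2, p.1 - (2⁻¹ : ℝ) • p.2)) volume volume := by
  have h1 : MeasurePreserving (fun p : Rd d × Rd d => (p.1, p.2 + (2⁻¹ : ℝ) • p.1))
      (volume.prod volume) (volume.prod volume) :=
    (MeasurePreserving.id volume).skew_product (g := fun y x => x + (2⁻¹ : ℝ) • y)
      (by fun_prop)
      (Filter.Eventually.of_forall fun y => map_add_right_eq_self _ _)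
  have h2 : MeasurePreserving (fun p : Rd d × Rd d => (p.1, p.1 - p.2))
      (volume.prod volume) (volume.prod volume) :=
    (MeasurePreserving.id volume).skew_product (g := fun u y => u - y) (by fun_prop)
      (Filter.Eventually.of_forall fun u => Measure.map_sub_left_eq_self _ u)
  have h3 := h2.comp (Measure.measurePreserving_swap.comp
    (h1.comp Measure.measurePreserving_swap))
  have e : (fun p : Rd d × Rd d => (p.1 + (2⁻¹ : ℝ) • p.2, p.1 - (2⁻¹ : ℝ) • p.2)) =
      (fun p : Rd d × Rd d => (p.1, p.1 - p.2)) ∘ Prod.swap ∘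
        (fun p : Rd d × Rd d => (p.1, p.2 + (2⁻¹ : ℝ) • p.1)) ∘ Prod.swap := by
    ext1 p
    simp only [Function.comp_apply, Prod.swap, Prod.mk.injEq, true_and]
    module
  rw [e]
  exact h3

/-- Parseval's identity for two integrable functions, the second of them Schwartz. -/
theorem integral_fourier_mul_conj_fourier {F : Rd d → ℂ} (hF : Integrable F) (G : 𝓢(Rd d, ℂ)) :
    ∫ ξ, 𝓕 F ξ * conj (𝓕 G ξ) = ∫ y, F y * conj (G y) := by
  -- The multiplication formula `∫ 𝓕F · k = ∫ F · 𝓕k` with `k = conj (𝓕 G)`; Fourier inversion then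
  -- gives `𝓕k = conj G`.
  have h := VectorFourier.integral_fourierIntegral_smul_eq_flip (μ := volume) (ν := volume)
    (L := innerₗ (Rd d)) Real.continuous_fourierChar (by exact continuous_inner) hF
    ((conjSchwartz (𝓕 G)).integrable)
  have e : ∀ y, 𝓕 (conjSchwartz (𝓕 G) : Rd d → ℂ) y = conj (G y) := fun y => by
    rw [← congrArg (fun F : 𝓢(Rd d, ℂ) => F y)
        (FourierTransform.fourierInv_fourier_eq (F := 𝓢(Rd d, ℂ)) G),
      SchwartzMap.fourierInv_coe, Real.fourier_eq, Real.fourierInv_eq, ← integral_conj]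
    congr 1 with ξ
    rw [conjSchwartz_apply, Circle.smul_def, Circle.smul_def, smul_eq_mul, smul_eq_mul, map_mul,
      ← Circle.coe_inv_eq_conj, AddChar.map_neg_eq_inv]
  simp only [flip_innerₗ] at h
  calc _ = _ := h
    _ = _ := by
      congr 1 with y
      rw [smul_eq_mul, ← e]
      rfl

/-- For fixed `x`, Parseval in `ξ` removes both Fourier transforms. The variables `x ± y/2` then
split the double integral into a product. Only `g` is Schwartz, as `f` will be an arbitrary `L²`
function. -/
theorem integral_wigner_mul_conj_wigner (hf : StronglyMeasurable f) (hf2 : MemLp f 2 volume)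
    (g : 𝓢(Rd d, ℂ)) :
    ∫ w, wigner f w * conj (wigner g w) =
      (∫ x, f x * conj (g x)) * conj (∫ x, f x * conj (g x)) := by
  have hi := integrable_wigner_mul_conj hf hf2 (integrable_wigner_schwartz g)
  have hfg : Integrable fun x => f x * conj (g x) :=
    MemLp.integrable_mul (p := 2) (q := 2) hf2 ((conjSchwartz g).memLp 2 volume)
  have hK : Integrable (fun p : Rd d × Rd d =>
      (f p.1 * conj (g p.1)) * conj (f p.2 * conj (g p.2))) :=
    hfg.mul_prod (Complex.conjLIE.integrable_comp_iff.2 hfg)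
  have hK' := measurePreserving_add_half_sub_half.integrable_comp_of_integrable hK
  calc ∫ w, wigner f w * conj (wigner g w)
      = ∫ x, ∫ ξ, wigner f (x, ξ) * conj (wigner g (x, ξ)) := integral_prod _ hi
    _ = ∫ x, ∫ y, (f (x + (2⁻¹ : ℝ) • y) * conj (g (x + (2⁻¹ : ℝ) • y))) *
          conj (f (x - (2⁻¹ : ℝ) • y) * conj (g (x - (2⁻¹ : ℝ) • y))) := by
        congr 1 with x
        simp_rw [wigner_schwartz, wigner_eq_fourier]
        rw [integral_fourier_mul_conj_fourier (integrable_wigner_integrand hf hf2 x).1]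
        congr 1 with y
        simp only [slice_apply, conjSchwartz_apply, map_mul, Complex.conj_conj]
        ring
    _ = ∫ p : Rd d × Rd d, (f (p.1 + (2⁻¹ : ℝ) • p.2) * conj (g (p.1 + (2⁻¹ : ℝ) • p.2))) *
          conj (f (p.1 - (2⁻¹ : ℝ) • p.2) * conj (g (p.1 - (2⁻¹ : ℝ) • p.2))) :=
        (integral_prod _ hK').symm
    _ = ∫ p : Rd d × Rd d, (f p.1 * conj (g p.1)) * conj (f p.2 * conj (g p.2)) := by
        have h := measurePreserving_add_half_sub_half (d := d)
        have hm := hK.1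
        rw [← h.map_eq] at hm
        have := integral_map h.measurable.aemeasurable hm
        rw [h.map_eq] at this
        exact this.symm
    _ = _ := by
        rw [← integral_conj]
        exact integral_prod_mul (fun x => f x * conj (g x)) fun x => conj (f x * conj (g x))

theorem integral_wigner (g : 𝓢(Rd d, ℂ)) :
    ∫ w, wigner (g : Rd d → ℂ) w = ∫ x, g x * conj (g x) := by
  rw [Measure.volume_eq_prod, integral_prod _ (integrable_wigner_schwartz g)]
  congr 1 with x
  -- Fourier inversion at `y = 0` gives the marginal `∫ W_g(x, ξ) dξ = |g(x)|²`.
  have h := congrArg (fun F : 𝓢(Rd d, ℂ) => F 0)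
    (FourierTransform.fourierInv_fourier_eq (F := 𝓢(Rd d, ℂ)) (slice g (conjSchwartz g) x))
  simp only [SchwartzMap.fourierInv_coe, Real.fourierInv_eq, slice_apply, conjSchwartz_apply,
    inner_zero_right, AddChar.map_zero_eq_one, one_smul, smul_zero, add_zero, sub_zero] at h
  simp_rw [wigner_schwartz]
  exact h

theorem phasePairing_wigner_wigner (u : L2 d) (g : 𝓢(Rd d, ℂ)) :
    phasePairing (wigner u) (wigner g) = ((‖inner ℂ (g.toLp 2 volume) u‖ ^ 2 : ℝ) : ℂ) := by
  rw [phasePairing, integral_wigner_mul_conj_wigner (Lp.stronglyMeasurable u) (Lp.memLp u) g,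
    Complex.mul_conj, Complex.normSq_eq_norm_sq]
  congr 3
  rw [L2.inner_def]
  refine integral_congr_ae ?_
  filter_upwards [g.coeFn_toLp 2 volume] with x hx
  rw [hx, RCLike.inner_apply]

theorem phasePairing_one_wigner (g : 𝓢(Rd d, ℂ)) :
    phasePairing (fun _ => 1) (wigner g) = ((‖g.toLp 2 volume‖ ^ 2 : ℝ) : ℂ) := by
  have h : (∫ x, g x * conj (g x)) = ((‖g.toLp 2 volume‖ ^ 2 : ℝ) : ℂ) := by
    rw [Complex.ofReal_pow]
    refine Eq.trans ?_ (inner_self_eq_norm_sq_to_K (𝕜 := ℂ) (g.toLp 2 volume))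
    rw [SchwartzMap.inner_toL2_toL2_eq g g volume]
    rfl
  simp only [phasePairing, one_mul]
  rw [integral_conj, integral_wigner, h, Complex.conj_ofReal]

end Moyal

/-! ### Continuous Parseval frames: density and polarization. -/

section Frame

open Filter Topology

variable {X ℋ : Type*} [MeasurableSpace X] [NormedAddCommGroup ℋ] [InnerProductSpace ℂ ℋ]
  {ν : Measure X} {u : X → ℋ}

/-- A continuous Parseval identity on a dense set gives a Bessel bound on the whole space. -/
theorem integrable_norm_inner_sq_of_dense {S : Set ℋ} (hS : Dense S)
    (h : ∀ s ∈ S, Integrable (fun x => ‖inner ℂ (u x) s‖ ^ 2) ν ∧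
      ∫ x, ‖inner ℂ (u x) s‖ ^ 2 ∂ν = ‖s‖ ^ 2) (g : ℋ) :
    Integrable (fun x => ‖inner ℂ (u x) g‖ ^ 2) ν ∧
      ∫ x, ‖inner ℂ (u x) g‖ ^ 2 ∂ν ≤ ‖g‖ ^ 2 := by
  obtain ⟨s, hs, hsg⟩ := mem_closure_iff_seq_limit.1 (hS g)
  have hlim : ∀ x, Tendsto (fun n => ‖inner ℂ (u x) (s n)‖ ^ 2) atTop
      (𝓝 (‖inner ℂ (u x) g‖ ^ 2)) := fun x =>
    ((tendsto_const_nhds.inner hsg).norm).pow 2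
  have hm : AEStronglyMeasurable (fun x => ‖inner ℂ (u x) g‖ ^ 2) ν :=
    aestronglyMeasurable_of_tendsto_ae atTop (fun n => (h _ (hs n)).1.1)
      (Eventually.of_forall hlim)
  have hn : ∀ n, ∫⁻ x, ENNReal.ofReal (‖inner ℂ (u x) (s n)‖ ^ 2) ∂ν =
      ENNReal.ofReal (‖s n‖ ^ 2) := fun n => by
    rw [← (h _ (hs n)).2, ofReal_integral_eq_lintegral_ofReal (h _ (hs n)).1
      (Eventually.of_forall fun x => by positivity)]
  have hle : ∫⁻ x, ENNReal.ofReal (‖inner ℂ (u x) g‖ ^ 2) ∂ν ≤ ENNReal.ofReal (‖g‖ ^ 2) := by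
    -- Fatou's lemma along a sequence in `S` converging to `g`.
    calc ∫⁻ x, ENNReal.ofReal (‖inner ℂ (u x) g‖ ^ 2) ∂ν
        = ∫⁻ x, liminf (fun n => ENNReal.ofReal (‖inner ℂ (u x) (s n)‖ ^ 2)) atTop ∂ν := by
          congr 1 with x
          exact (ENNReal.tendsto_ofReal (hlim x)).liminf_eq.symm
      _ ≤ liminf (fun n => ∫⁻ x, ENNReal.ofReal (‖inner ℂ (u x) (s n)‖ ^ 2) ∂ν) atTop :=
          lintegral_liminf_le' fun n => (h _ (hs n)).1.1.aemeasurable.ennreal_ofReal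
      _ = ENNReal.ofReal (‖g‖ ^ 2) := by
          simp_rw [hn]
          exact (ENNReal.tendsto_ofReal (hsg.norm.pow 2)).liminf_eq
  have hi : Integrable (fun x => ‖inner ℂ (u x) g‖ ^ 2) ν :=
    ⟨hm, by
      rw [hasFiniteIntegral_iff_ofReal (Eventually.of_forall fun x => by positivity)]
      exact hle.trans_lt ENNReal.ofReal_lt_top⟩
  refine ⟨hi, ?_⟩
  rwa [← ofReal_integral_eq_lintegral_ofReal hi (Eventually.of_forall fun x => by positivity),
    ENNReal.ofReal_le_ofReal_iff (by positivity)] at hle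

theorem norm_sq_add_norm_sub_sub_sq {K : Type*} [NormedAddCommGroup K] [InnerProductSpace ℂ K]
    (a b : K) : ‖a‖ ^ 2 + ‖a - b - b‖ ^ 2 = 2 * ‖a - b‖ ^ 2 + 2 * ‖b‖ ^ 2 := by
  have := parallelogram_law_with_norm ℂ (a - b) b
  rw [sub_add_cancel] at this
  linarith

/-- A continuous Parseval identity passes from a dense set to the whole space. -/
theorem integral_norm_inner_sq_of_dense {S : Set ℋ} (hS : Dense S)
    (h : ∀ s ∈ S, Integrable (fun x => ‖inner ℂ (u x) s‖ ^ 2) ν ∧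
      ∫ x, ‖inner ℂ (u x) s‖ ^ 2 ∂ν = ‖s‖ ^ 2) (g : ℋ) :
    Integrable (fun x => ‖inner ℂ (u x) g‖ ^ 2) ν ∧
      ∫ x, ‖inner ℂ (u x) g‖ ^ 2 ∂ν = ‖g‖ ^ 2 := by
  have hB := integrable_norm_inner_sq_of_dense hS h
  refine ⟨(hB g).1, le_antisymm (hB g).2 (le_of_forall_pos_le_add fun ε hε => ?_)⟩
  obtain ⟨s, hs, hsε⟩ := Metric.mem_closure_iff.1 (hS g) (Real.sqrt (ε / 2))
    (Real.sqrt_pos.2 (by positivity))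
  rw [dist_eq_norm, Real.lt_sqrt (norm_nonneg _)] at hsε
  -- Write `Q` for the integral as a quadratic form. From `Q(g) + Q(g - 2s) = 2Q(g - s) + 2‖s‖²`,
  -- `Q(g - 2s) ≤ ‖g - 2s‖²` and `Q(g - s) ≥ 0` one gets `Q(g) ≥ ‖g‖² - 2‖g - s‖²`, hence the choice
  -- `‖g - s‖² < ε/2`. Only squared moduli are integrated, since measurability of the coefficients
  -- themselves is not given.
  have hQ : (∫ x, ‖inner ℂ (u x) g‖ ^ 2 ∂ν) + ∫ x, ‖inner ℂ (u x) (g - s - s)‖ ^ 2 ∂ν =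
      2 * (∫ x, ‖inner ℂ (u x) (g - s)‖ ^ 2 ∂ν) + 2 * ‖s‖ ^ 2 := by
    rw [← (h s hs).2, ← integral_add (hB _).1 (hB _).1, ← integral_const_mul,
      ← integral_const_mul, ← integral_add ((hB _).1.const_mul 2) ((hB _).1.const_mul 2)]
    congr 1 with x
    simp only [inner_sub_right]
    exact norm_sq_add_norm_sub_sub_sq _ _
  have h0 : 0 ≤ ∫ x, ‖inner ℂ (u x) (g - s)‖ ^ 2 ∂ν := integral_nonneg fun x => by positivity
  linarith [norm_sq_add_norm_sub_sub_sq g s, (hB (g - s - s)).2]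

/-- Polarization of a continuous Parseval identity. -/
theorem integral_inner_mul_inner_of_norm_sq
    (h : ∀ g : ℋ, Integrable (fun x => ‖inner ℂ (u x) g‖ ^ 2) ν ∧
      ∫ x, ‖inner ℂ (u x) g‖ ^ 2 ∂ν = ‖g‖ ^ 2) (f g : ℋ) :
    Integrable (fun x => inner ℂ (u x) f * inner ℂ g (u x)) ν ∧
      ∫ x, inner ℂ (u x) f * inner ℂ g (u x) ∂ν = inner ℂ g f := by
  have hi : ∀ k : ℋ, Integrable (fun x => (((‖inner ℂ (u x) k‖ ^ 2 : ℝ) : ℂ))) ν :=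
    fun k => (h k).1.ofReal
  have hv : ∀ k : ℋ, ∫ x, ((‖inner ℂ (u x) k‖ ^ 2 : ℝ) : ℂ) ∂ν = ((‖k‖ ^ 2 : ℝ) : ℂ) :=
    fun k => by rw [integral_complex_ofReal, (h k).2]
  -- Polarization in `ℂ`, applied to the coefficients, makes the product a combination of four
  -- integrable squares, which also settles its measurability. Polarization in `ℋ` reassembles the
  -- right-hand side at the end.
  have e : (fun x => inner ℂ (u x) f * inner ℂ g (u x)) = fun x =>
      (((‖inner ℂ (u x) (g + f)‖ ^ 2 : ℝ) : ℂ) - ((‖inner ℂ (u x) (g - f)‖ ^ 2 : ℝ) : ℂ) +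
        (((‖inner ℂ (u x) (g - Complex.I • f)‖ ^ 2 : ℝ) : ℂ) -
          ((‖inner ℂ (u x) (g + Complex.I • f)‖ ^ 2 : ℝ) : ℂ)) * Complex.I) / 4 := by
    ext1 x
    have := inner_eq_sum_norm_sq_div_four (𝕜 := ℂ) (inner ℂ (u x) g) (inner ℂ (u x) f)
    rw [RCLike.inner_apply, inner_conj_symm] at this
    rw [this]
    simp only [inner_add_right, inner_sub_right, inner_smul_right, Complex.ofReal_pow]
    rfl
  have i1 := (hi (g + f)).sub (hi (g - f))
  have i2 := ((hi (g - Complex.I • f)).sub (hi (g + Complex.I • f))).mul_const Complex.I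
  rw [e]
  refine ⟨(i1.add i2).div_const 4, ?_⟩
  rw [integral_div]
  refine Eq.trans (congrArg (· / 4) (integral_add i1 i2)) ?_
  rw [integral_mul_const, integral_sub (hi _) (hi _), integral_sub (hi _) (hi _), hv, hv, hv, hv,
    inner_eq_sum_norm_sq_div_four g f]
  simp only [Complex.ofReal_pow]
  rfl

end Frame

/-! ### Both conditions as Parseval identities. -/

section Window

variable {d : ℕ} {H : Type*} [Group H] [MeasurableSpace H]

theorem integrable_of_mem_wignerSpan {F : Rd d × Rd d → ℂ} (hF : F ∈ wignerSpan d) :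
    Integrable F := by
  refine Submodule.span_induction ?_ (integrable_zero _ _ _) (fun _ _ _ _ => Integrable.add)
    (fun c _ _ h => h.smul c) hF
  rintro _ ⟨g, rfl⟩
  exact integrable_wigner_schwartz g

theorem phasePairing_add {W F G : Rd d × Rd d → ℂ} (hF : Integrable fun w => W w * conj (F w))
    (hG : Integrable fun w => W w * conj (G w)) :
    phasePairing W (F + G) = phasePairing W F + phasePairing W G := by
  simp only [phasePairing, Pi.add_apply, map_add, mul_add]
  exact integral_add hF hG

theorem phasePairing_smul (W F : Rd d × Rd d → ℂ) (c : ℂ) :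
    phasePairing W (c • F) = conj c * phasePairing W F := by
  simp only [phasePairing, Pi.smul_apply, smul_eq_mul, map_mul, mul_left_comm _ (conj c)]
  exact integral_const_mul _ _

/-- On the generators `W_g` this is Moyal's identity together with the marginal property. Conjugate
linearity in `F` extends it to the span; additivity there needs the pairings to converge absolutely.
-/
theorem isWeaklyAdmissibleWindow_iff_norm_sq {ι : H →* PhaseGroup d} {ν : Measure H}
    {φ : L2 d} : IsWeaklyAdmissibleWindow ι ν φ ↔ ∀ g : 𝓢(Rd d, ℂ),
      Integrable (fun h => ‖inner ℂ (extMetaplectic (ι h) φ) (g.toLp 2 volume)‖ ^ 2) ν ∧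
        ∫ h, ‖inner ℂ (extMetaplectic (ι h) φ) (g.toLp 2 volume)‖ ^ 2 ∂ν =
          ‖g.toLp 2 volume‖ ^ 2 := by
  have key : ∀ g : 𝓢(Rd d, ℂ),
      (Integrable (fun h => phasePairing (wigner (extMetaplectic (ι h) φ)) (wigner g)) ν ∧
        ∫ h, phasePairing (wigner (extMetaplectic (ι h) φ)) (wigner g) ∂ν =
          phasePairing (fun _ => 1) (wigner g)) ↔
      (Integrable (fun h => ‖inner ℂ (extMetaplectic (ι h) φ) (g.toLp 2 volume)‖ ^ 2) ν ∧
        ∫ h, ‖inner ℂ (extMetaplectic (ι h) φ) (g.toLp 2 volume)‖ ^ 2 ∂ν =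
          ‖g.toLp 2 volume‖ ^ 2) := fun g => by
    simp only [phasePairing_wigner_wigner, phasePairing_one_wigner, norm_inner_symm (g.toLp 2 _)]
    refine and_congr ⟨fun h => ?_, fun h => h.ofReal⟩ ?_
    · exact h.re
    · rw [integral_complex_ofReal, Complex.ofReal_inj]
  refine ⟨fun h g => (key g).1 (h _ (Submodule.subset_span ⟨g, rfl⟩)), fun h F hF => ?_⟩
  have hW : ∀ (k : H) {F : Rd d × Rd d → ℂ}, F ∈ wignerSpan d →
      Integrable fun w => wigner (extMetaplectic (ι k) φ) w * conj (F w) := fun k _ hF =>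
    integrable_wigner_mul_conj (Lp.stronglyMeasurable _) (Lp.memLp _)
      (integrable_of_mem_wignerSpan hF)
  have h1 : ∀ {F : Rd d × Rd d → ℂ}, F ∈ wignerSpan d →
      Integrable fun w => (1 : ℂ) * conj (F w) := fun hF => by
    simp only [one_mul]
    exact Complex.conjLIE.integrable_comp_iff.2 (integrable_of_mem_wignerSpan hF)
  refine Submodule.span_induction ?_ ?_ (fun F G hF hG iF iG => ?_) (fun c F hF iF => ?_) hF
  · rintro _ ⟨g, rfl⟩
    exact (key g).2 (h g)
  · simp [phasePairing]
  · simp only [phasePairing_add (hW _ hF) (hW _ hG), phasePairing_add (h1 hF) (h1 hG)]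
    exact ⟨iF.1.add iG.1, by rw [integral_add iF.1 iG.1, iF.2, iG.2]⟩
  · simp only [phasePairing_smul]
    exact ⟨iF.1.const_mul _, by rw [integral_const_mul, iF.2]⟩

/-- One direction is the diagonal `f = g`, the other is polarization. -/
theorem isReproducingFunction_iff_norm_sq {ι : H →* PhaseGroup d} {ν : Measure H}
    {φ : L2 d} : IsReproducingFunction ι ν φ ↔ ∀ g : L2 d,
      Integrable (fun h => ‖inner ℂ (extMetaplectic (ι h) φ) g‖ ^ 2) ν ∧
        ∫ h, ‖inner ℂ (extMetaplectic (ι h) φ) g‖ ^ 2 ∂ν = ‖g‖ ^ 2 := by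
  refine ⟨fun h g => ?_, fun h => integral_inner_mul_inner_of_norm_sq h⟩
  obtain ⟨h1, h2⟩ := h g g
  have e : ∀ k, inner ℂ (extMetaplectic (ι k) φ) g * inner ℂ g (extMetaplectic (ι k) φ) =
      ((‖inner ℂ (extMetaplectic (ι k) φ) g‖ ^ 2 : ℝ) : ℂ) := fun k => by
    rw [← inner_conj_symm g, Complex.mul_conj, Complex.normSq_eq_norm_sq]
  simp only [e] at h1 h2
  refine ⟨h1.re, ?_⟩
  rw [integral_complex_ofReal, inner_self_eq_norm_sq_to_K] at h2
  exact Complex.ofReal_injective (h2.trans (Complex.ofReal_pow _ _).symm)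

/-- The two Parseval identities are tested on `𝓢` and on `L²` respectively, and `𝓢` is dense in
`L²`. -/
theorem isWeaklyAdmissibleWindow_iff_isReproducingFunction {ι : H →* PhaseGroup d}
    {ν : Measure H} {φ : L2 d} :
    IsWeaklyAdmissibleWindow ι ν φ ↔ IsReproducingFunction ι ν φ := by
  rw [isWeaklyAdmissibleWindow_iff_norm_sq, isReproducingFunction_iff_norm_sq]
  refine ⟨fun h => integral_norm_inner_sq_of_dense
    (SchwartzMap.denseRange_toLpCLM (p := 2) (by norm_num)) ?_, fun h g => h _⟩
  rintro _ ⟨g, rfl⟩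
  exact h g

end Window

end PhaseSpace

end

/-- Connected Lie subgroups of `G = ℝ²ᵈ ⋊ Sp(d, ℝ)`, closed or merely immersed, are given by a
connected locally compact group `H` with its own topology and an injective continuous homomorphism
`ι` into `G` (for a closed subgroup, the inclusion). The measure `ν` is any left Haar measure. -/
theorem theorem3p3 {d : ℕ} {H : Type*} [Group H] [TopologicalSpace H] [IsTopologicalGroup H]
    [LocallyCompactSpace H] [ConnectedSpace H] [MeasurableSpace H] [BorelSpace H]
    (ι : H →* PhaseSpace.PhaseGroup d) (hι : Function.Injective ι) (hιc : Continuous ι)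
    (ν : MeasureTheory.Measure H) [ν.IsHaarMeasure] (φ : PhaseSpace.L2 d) :
    (PhaseSpace.IsWeaklyAdmissible ι ν ∧ PhaseSpace.IsWeaklyAdmissibleWindow ι ν φ) ↔
      (PhaseSpace.IsReproducing ι ν ∧ PhaseSpace.IsReproducingFunction ι ν φ) := by
  have h := fun ψ : PhaseSpace.L2 d =>
    PhaseSpace.isWeaklyAdmissibleWindow_iff_isReproducingFunction (ι := ι) (ν := ν) (φ := ψ)
  exact and_congr (exists_congr h) (h φ)
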